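/- Let $\mathbb{Q}(\alpha)$ be the field of rational functions in a parameter $\alpha$. For a partition $\lambda$ with conjugate $\lambda^t$ put $b(\lambda)=\sum_i\binom{\lambda_i}{2}$ and $\mathrm{hook}_\alpha(\lambda)=\prod_{\square\in\lambda}\bigl(\alpha\,a(\square)+\ell(\square)+1\bigr)$, where $a(\square)$ and $\ell(\square)$ are the arm and the leg of the box $\square$ in the Young diagram of $\lambda$. For $N\ge 0$ consider the Laplace--Beltrami operator in the variables $x_1,\dots,x_N$, $$D_\alpha=\sum_{i\le N}\sum_{j\ne i}\frac{x_i^2}{x_i-x_j}\frac{\partial}{\partial x_i}+\frac{\alpha}{2}\sum_{i\le N}x_i^2\frac{\partial^2}{\partial x_i^2}.$$ (1) For every $N$ and every partition $\lambda$ of length at most $N$ there is a unique symmetric polynomial $J_\lambda=J^{(\alpha)}_\lambda(x_1,\dots,x_N)$ over $\mathbb{Q}(\alpha)$, the Jack polynomial, such that $$D_\alpha J_\lambda=\bigl(\alpha\, b(\lambda)-b(\lambda^t)+(N-1)|\lambda|\bigr)J_\lambda\qquad\text{and}\qquad J_\lambda=\mathrm{hook}_\alpha(\lambda)\,m_\lambda+\sum_{\nu<\lambda}a^\lambda_\nu\,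 m_\nu\ \text{ for some } a^\lambda_\nu\in\mathbb{Q}(\alpha),$$ where $m_\nu$ are the monomial symmetric polynomials and $<$ is the strict dominance order on partitions of the same size. If $\lambda$ has more than $N$ parts, put $J_\lambda(x_1,\dots,x_N)=0$. (2) For every $N$ and $\lambda$ one has $J_\lambda(x_1,\dots,x_N,0)=J_\lambda(x_1,\dots,x_N)$, so that the Jack polynomials define symmetric functions. (3) Let $r\ge 1$ and let $\lambda^1,\dots,\lambda^r$ be partitions. For $B\subseteq[r]=\{1,\dots,r\}$ let $\lambda^B$ be the entry-wise sum of the $\lambda^i$, $i\in B$, and define the cumulant of Jack polynomials $$\kappa^J(\lambda^1,\dots,\lambda^r)=\sum_{\pi}\mu(\pi,\{[r]\})\prod_{B\in\pi}J_{\lambda^B},$$ where $\pi$ runs over the set partitions of $[r]$ and $\mu$ is the Möbius function of the lattice of set partitions of $[r]$ ordered by refinement. Then $$\kappa^J(\lambda^1,\dots,\lambda^r)=O(\alpha^{r-1})\quad\text{as }\alpha\to 0,$$ that is, in any number $N$ of variables, every coefficient $c\in\mathbb{Q}(\alpha)$ of this polynomial is such that $\alpha^{-(r-1)}c$ has no pole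 at $\alpha=0$. -/

import Mathlib

noncomputable section

namespace JackCumulant

/-! ### Partitions, represented by their Young diagrams

The `i`-th part of `lam` (counted from `0`) is `lam.rowLen i`, its length is `lam.colLen 0`, its size
is `lam.card`, and its conjugate is `lam.transpose`. -/

/-- The entry-wise sum `⨁_{i ∈ B} lam i`: its `k`-th part is the sum of the `k`-th parts of the
`lam i`, `i ∈ B` (see `rowLen_entrywiseSum`). The product of two ranges is only a bounding box. -/
def entrywiseSum {ι : Type*} (lam : ι → YoungDiagram) (B : Finset ι) : YoungDiagram where
  cells := ((Finset.range (∑ i ∈ B, (lam i).colLen 0)) ×ˢ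
    (Finset.range (∑ i ∈ B, (lam i).rowLen 0))).filter
      (fun c => c.2 < ∑ i ∈ B, (lam i).rowLen c.1)
  isLowerSet := by
    rintro ⟨a, b⟩ ⟨c, d⟩ ⟨h1, h2⟩ h
    simp only [Finset.coe_filter, Finset.mem_product, Finset.mem_range, Set.mem_ofPred_eq] at h ⊢
    simp only at h1 h2
    have := Finset.sum_le_sum (fun i (_ : i ∈ B) => (lam i).rowLen_anti c a h1)
    omega

theorem rowLen_entrywiseSum {ι : Type*} (lam : ι → YoungDiagram) (B : Finset ι) (k : ℕ) :
    (entrywiseSum lam B).rowLen k = ∑ i ∈ B, (lam i).rowLen k := by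
  have key : ∀ j, j < (entrywiseSum lam B).rowLen k ↔ j < ∑ i ∈ B, (lam i).rowLen k := by
    intro j
    rw [← YoungDiagram.mem_iff_lt_rowLen, ← YoungDiagram.mem_cells]
    simp only [entrywiseSum, Finset.mem_filter, Finset.mem_product, Finset.mem_range,
      and_iff_right_iff_imp]
    intro h
    constructor
    · obtain ⟨i, hi, hpos⟩ : ∃ i ∈ B, 0 < (lam i).rowLen k := by
        by_contra hcon
        push Not at hcon
        have : ∑ i ∈ B, (lam i).rowLen k = 0 :=
          Finset.sum_eq_zero (fun i hi => Nat.le_zero.mp (hcon i hi))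
        omega
      have h1 : k < (lam i).colLen 0 :=
        YoungDiagram.mem_iff_lt_colLen.mp (YoungDiagram.mem_iff_lt_rowLen.mpr hpos)
      exact lt_of_lt_of_le h1
        (Finset.single_le_sum (f := fun i => (lam i).colLen 0) (fun _ _ => Nat.zero_le _) hi)
    · exact lt_of_lt_of_le h
        (Finset.sum_le_sum (fun i _ => (lam i).rowLen_anti 0 k (Nat.zero_le k)))
  have h1 := key ((entrywiseSum lam B).rowLen k)
  have h2 := key (∑ i ∈ B, (lam i).rowLen k)
  omega

/-- `nu` is strictly smaller than `lam` in dominance order (on partitions of the same size). -/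
def DominanceLT (nu lam : YoungDiagram) : Prop :=
  nu.card = lam.card ∧ nu ≠ lam ∧
    ∀ j : ℕ, ∑ i ∈ Finset.range j, nu.rowLen i ≤ ∑ i ∈ Finset.range j, lam.rowLen i

/-- `b(lam) = ∑ i, binom (lam_i) 2`. -/
def bStat (lam : YoungDiagram) : ℕ :=
  ∑ i ∈ Finset.range (lam.colLen 0), (lam.rowLen i).choose 2

/-! ### Jack polynomials -/

/-- The field `ℚ(α)` of rational functions in the Jack parameter. -/
abbrev QAlpha : Type := RatFunc ℚ

/-- The Jack parameter `α`. -/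
abbrev alpha : QAlpha := RatFunc.X

/-- The `α`-hook polynomial `∏_{□ ∈ lam} (α a(□) + ℓ(□) + 1)`. For the box `c` in row `c.1` and
column `c.2` (counted from `0`) the arm is `lam.rowLen c.1 - (c.2 + 1)` and the leg is
`lam.colLen c.2 - (c.1 + 1)`; neither subtraction truncates, as `c ∈ lam`. -/
def hook (lam : YoungDiagram) : QAlpha :=
  ∏ c ∈ lam.cells, (alpha * ((lam.rowLen c.1 - (c.2 + 1) : ℕ) : QAlpha)
    + ((lam.colLen c.2 - (c.1 + 1) : ℕ) : QAlpha) + 1)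

/-- The monomial symmetric polynomial `m_lam(x_1, …, x_N)` (zero if `lam` has more than `N` parts). -/
def monomialSymm (N : ℕ) (lam : YoungDiagram) : MvPolynomial (Fin N) QAlpha :=
  MvPolynomial.msymm (Fin N) QAlpha (Nat.Partition.ofMultiset (lam.rowLens : Multiset ℕ))

/-- The field `ℚ(α)(x_1, …, x_N)`. -/
abbrev RatField (N : ℕ) : Type := FractionRing (MvPolynomial (Fin N) QAlpha)

/-- The embedding of polynomials in `x_1, …, x_N` into rational functions. -/
abbrev toRat (N : ℕ) : MvPolynomial (Fin N) QAlpha →+* RatField N :=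
  algebraMap (MvPolynomial (Fin N) QAlpha) (RatField N)

/-- `D_1 f = ∑_i ∑_{j ≠ i} x_i² / (x_i - x_j) ∂f/∂x_i`, computed among rational functions. -/
def D1 (N : ℕ) (f : MvPolynomial (Fin N) QAlpha) : RatField N :=
  ∑ i : Fin N, ∑ j ∈ Finset.univ.filter (fun j : Fin N => j ≠ i),
    toRat N (MvPolynomial.X i ^ 2) / toRat N (MvPolynomial.X i - MvPolynomial.X j)
      * toRat N (MvPolynomial.pderiv i f)

/-- `D_2 f = (1/2) ∑_i x_i² ∂²f/∂x_i²`. -/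
def D2 (N : ℕ) (f : MvPolynomial (Fin N) QAlpha) : MvPolynomial (Fin N) QAlpha :=
  MvPolynomial.C (1 / 2) * ∑ i : Fin N,
    MvPolynomial.X i ^ 2 * MvPolynomial.pderiv i (MvPolynomial.pderiv i f)

/-- The Laplace–Beltrami operator `D_α = D_1 + α D_2`. -/
def laplaceBeltrami (N : ℕ) (f : MvPolynomial (Fin N) QAlpha) : RatField N :=
  D1 N f + toRat N (MvPolynomial.C alpha * D2 N f)

/-- The eigenvalue `α b(lam) - b(lamᵗ) + (N - 1) |lam|`. -/
def eigenvalue (N : ℕ) (lam : YoungDiagram) : QAlpha :=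
  alpha * (bStat lam : QAlpha) - (bStat lam.transpose : QAlpha)
    + ((N : QAlpha) - 1) * (lam.card : QAlpha)

/-- The characterization of the Jack polynomial in `N` variables indexed by `lam`. -/
structure IsJack (N : ℕ) (lam : YoungDiagram) (P : MvPolynomial (Fin N) QAlpha) : Prop where
  symmetric : P.IsSymmetric
  eigen : laplaceBeltrami N P = toRat N (MvPolynomial.C (eigenvalue N lam) * P)
  expansion : ∃ a : YoungDiagram →₀ QAlpha, (∀ nu ∈ a.support, DominanceLT nu lam) ∧
    P = MvPolynomial.C (hook lam) * monomialSymm N lam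
      + ∑ nu ∈ a.support, MvPolynomial.C (a nu) * monomialSymm N nu

open Classical in
/-- The Jack polynomial `J_lam^{(α)}(x_1, …, x_N)`: for `lam` of length at most `N` the polynomial
characterized by `IsJack`, and `0` for longer `lam` (the restriction to `N` variables of the Jack
symmetric function). -/
def jack (N : ℕ) (lam : YoungDiagram) : MvPolynomial (Fin N) QAlpha :=
  if h : lam.colLen 0 ≤ N ∧ ∃ P, IsJack N lam P then h.2.choose else 0

/-- The substitution `x_{N+1} = 0`, from `N + 1` variables to `N` variables. -/
def restrictLast (N : ℕ) :
    MvPolynomial (Fin (N + 1)) QAlpha →ₐ[QAlpha] MvPolynomial (Fin N) QAlpha :=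
  MvPolynomial.aeval (Fin.snoc (α := fun _ => MvPolynomial (Fin N) QAlpha)
    (fun i : Fin N => MvPolynomial.X i) 0)

/-! ### Cumulants -/

open Classical in
/-- The value `μ(π, {H})` of the Möbius function of the lattice of set partitions of `H`, ordered by
refinement; `⊤` is the one-block partition. -/
def moebiusTop {ι : Type*} [DecidableEq ι] {H : Finset ι} (p : Finpartition H) : ℤ :=
  letI : LocallyFiniteOrder (Finpartition H) := Fintype.toLocallyFiniteOrder
  IncidenceAlgebra.mu ℤ p ⊤

/-- The cumulant `κ_H(u) = ∑_{π ∈ 𝒫(H)} μ(π, {H}) ∏_{B ∈ π} u_B`. -/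
def cumulant {ι R : Type*} [DecidableEq ι] [CommRing R] (u : Finset ι → R) (H : Finset ι) : R :=
  ∑ p : Finpartition H, (moebiusTop p : R) * ∏ B ∈ p.parts, u B

/-- The cumulant `κ^J(lam^1, …, lam^r)` of Jack polynomials, in the variables `x_1, …, x_N`. -/
def jackCumulant (N : ℕ) {r : ℕ} (lam : Fin r → YoungDiagram) : MvPolynomial (Fin N) QAlpha :=
  cumulant (fun B => jack N (entrywiseSum lam B)) Finset.univ

/-- `f = O(α^k)` as `α → 0`: the rational function `f * α^(-k)` has no pole at `0`. -/
def IsOAlpha (k : ℤ) (f : QAlpha) : Prop :=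
  (RatFunc.denom (f * alpha ^ (-k))).eval 0 ≠ 0

end JackCumulant

end

/-!
For the product `(f g)(H) = ∑_{A ⊆ H} f(A) g(H \ A)` of functions of finite sets, the cumulants of
a function with value `1` at `∅` are its logarithm. The operator `D_α = D₁ + α D₂` has a
derivation as its part of order zero in `α`, and `B ↦ J_{lam^B}` is a family of eigenvectors whose
eigenvalues are additive in `B` up to a multiple of `α`. Hence the cumulant of a set `H` satisfies
an eigenvector equation up to the error `α ∑ Γ(κ_A, κ_{H \ A})`, with `Γ` bilinear and first
order in each argument, and an induction on `H` makes this error `O(α^{|H| - 1})`. In the basis of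
monomials `D_α` is triangular for the dominance order, and the differences of its diagonal entries
have the form `a + α b` with integers `a ≠ 0` and `b`, which are invertible at `α = 0`. Therefore
all coefficients of the cumulant are `O(α^{|H| - 1})` as soon as the leading one is, and this is
the cumulant of the hook polynomials. These vary multiplicatively: the ratios `hook(lam^{B ∪ h}) /
hook(lam^B)` have `k`-th differences divisible by `α^k`, which forces small cumulants.
Triangularity alone also gives the existence, uniqueness and stability of the Jack polynomials.
-/

noncomputable section

namespace JackCumulant

/-! ### Rational functions regular at `α = 0` -/

theorem alpha_ne_zero : alpha ≠ 0 := RatFunc.X_ne_zero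

theorem eval_ne_zero_of_dvd {R : Type*} [CommSemiring R] {p q : Polynomial R} {x : R}
    (hpq : p ∣ q) (hq : q.eval x ≠ 0) : p.eval x ≠ 0 := fun hp => by
  simpa [hp, hq] using map_dvd (Polynomial.evalRingHom x) hpq

/-- The ring of rational functions in `α` without a pole at `0`. -/
def regularAtZero : Subring QAlpha where
  carrier := {f | f.denom.eval 0 ≠ 0}
  zero_mem' := by simp
  one_mem' := by simp
  add_mem' {f g} hf hg := by
    refine eval_ne_zero_of_dvd (RatFunc.denom_add_dvd f g) ?_
    rw [Polynomial.eval_mul]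
    exact mul_ne_zero hf hg
  mul_mem' {f g} hf hg := by
    refine eval_ne_zero_of_dvd (RatFunc.denom_mul_dvd f g) ?_
    rw [Polynomial.eval_mul]
    exact mul_ne_zero hf hg
  neg_mem' {f} hf := by
    refine eval_ne_zero_of_dvd (q := f.denom) ?_ hf
    rw [RatFunc.denom_dvd f.denom_ne_zero]
    exact ⟨-f.num, by rw [map_neg, neg_div, RatFunc.num_div_denom]⟩

theorem algebraMap_mem_regularAtZero (p : Polynomial ℚ) :
    algebraMap (Polynomial ℚ) QAlpha p ∈ regularAtZero := by
  simp [regularAtZero, ← SetLike.mem_coe]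

theorem inv_algebraMap_mem_regularAtZero {p : Polynomial ℚ} (hp : p.eval 0 ≠ 0) :
    (algebraMap (Polynomial ℚ) QAlpha p)⁻¹ ∈ regularAtZero := by
  have hp0 : p ≠ 0 := by rintro rfl; simp at hp
  refine eval_ne_zero_of_dvd (RatFunc.denom_inv_dvd ?_) (by rwa [RatFunc.num_algebraMap])
  rwa [map_ne_zero_iff _ (RatFunc.algebraMap_injective ℚ)]

theorem alpha_mem_regularAtZero : alpha ∈ regularAtZero := by
  simpa using algebraMap_mem_regularAtZero Polynomial.X

/-- The fractional ideal of `regularAtZero` generated by `α`; its powers encode the orders of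
vanishing at `α = 0`. -/
def alphaIdeal : Submodule regularAtZero QAlpha := Submodule.span regularAtZero {alpha}

theorem alpha_mem_alphaIdeal : alpha ∈ alphaIdeal := Submodule.mem_span_singleton_self alpha

theorem alphaIdeal_le_one : alphaIdeal ≤ 1 := by
  rw [alphaIdeal, Submodule.span_singleton_le_iff_mem, Submodule.mem_one]
  exact ⟨⟨alpha, alpha_mem_regularAtZero⟩, rfl⟩

theorem isOAlpha_iff_mem_alphaIdeal_pow {k : ℕ} {f : QAlpha} :
    IsOAlpha k f ↔ f ∈ alphaIdeal ^ k := by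
  have hk : alpha ^ k ≠ 0 := pow_ne_zero k alpha_ne_zero
  rw [alphaIdeal, Submodule.span_pow, Set.singleton_pow, Submodule.mem_span_singleton]
  change f * alpha ^ (-(k : ℤ)) ∈ regularAtZero ↔ _
  rw [zpow_neg, zpow_natCast, ← div_eq_mul_inv]
  constructor
  · exact fun h => ⟨⟨_, h⟩, div_mul_cancel₀ f hk⟩
  · rintro ⟨c, rfl⟩
    rw [Subring.smul_def, smul_eq_mul, mul_div_cancel_right₀ _ hk]
    exact c.2

theorem algebraMap_C_add_X_mul_C (a b : ℤ) :
    algebraMap (Polynomial ℚ) QAlpha (.C (a : ℚ) + .X * .C (b : ℚ)) = a + alpha * b := by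
  simp

theorem intCast_add_alpha_mul_ne_zero {a : ℤ} (ha : a ≠ 0) (b : ℤ) :
    (a : QAlpha) + alpha * b ≠ 0 := by
  rw [← algebraMap_C_add_X_mul_C, map_ne_zero_iff _ (RatFunc.algebraMap_injective ℚ)]
  exact fun h => ha (by simpa using congrArg (Polynomial.eval 0) h)

theorem inv_intCast_add_alpha_mul_mem_regularAtZero {a : ℤ} (ha : a ≠ 0) (b : ℤ) :
    ((a : QAlpha) + alpha * b)⁻¹ ∈ regularAtZero := by
  rw [← algebraMap_C_add_X_mul_C]
  exact inv_algebraMap_mem_regularAtZero (by simpa using ha)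

/-! ### Cumulants of set functions -/

section Convolution

variable {ι : Type*} [DecidableEq ι]

theorem sum_powerset_sdiff_comm {M : Type*} [AddCommMonoid M] (H : Finset ι)
    (F : Finset ι → Finset ι → M) :
    ∑ A ∈ H.powerset, ∑ C ∈ (H \ A).powerset, F A C =
      ∑ D ∈ H.powerset, ∑ A ∈ D.powerset, F A (D \ A) := by
  rw [Finset.sum_sigma', Finset.sum_sigma']
  refine Finset.sum_nbij' (fun x => ⟨x.1 ∪ x.2, x.1⟩) (fun x => ⟨x.2, x.1 \ x.2⟩) ?_ ?_ ?_ ?_ ?_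
  · rintro ⟨A, C⟩ h
    simp only [Finset.mem_sigma, Finset.mem_powerset] at h ⊢
    exact ⟨Finset.union_subset h.1 (h.2.trans Finset.sdiff_subset), Finset.subset_union_left⟩
  · rintro ⟨D, A⟩ h
    simp only [Finset.mem_sigma, Finset.mem_powerset] at h ⊢
    exact ⟨h.2.trans h.1, Finset.sdiff_subset_sdiff h.1 le_rfl⟩
  · rintro ⟨A, C⟩ h
    simp only [Finset.mem_sigma, Finset.mem_powerset] at h
    have : Disjoint A C := Finset.disjoint_of_subset_right h.2 Finset.disjoint_sdiff
    simp [Finset.union_sdiff_cancel_left this]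
  · rintro ⟨D, A⟩ h
    simp only [Finset.mem_sigma, Finset.mem_powerset] at h
    simp [Finset.union_sdiff_of_subset h.2]
  · rintro ⟨A, C⟩ h
    simp only [Finset.mem_sigma, Finset.mem_powerset] at h
    have : Disjoint A C := Finset.disjoint_of_subset_right h.2 Finset.disjoint_sdiff
    simp [Finset.union_sdiff_cancel_left this]

theorem sum_powerset_sdiff {M : Type*} [AddCommMonoid M] (H : Finset ι)
    (F : Finset ι → Finset ι → M) :
    ∑ A ∈ H.powerset, F A (H \ A) = ∑ A ∈ H.powerset, F (H \ A) A := by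
  refine Finset.sum_nbij' (H \ ·) (H \ ·) ?_ ?_ ?_ ?_ ?_
  · intro A _
    simp
  · intro A _
    simp
  · intro A h
    simpa using Finset.mem_powerset.mp h
  · intro A h
    simpa using Finset.mem_powerset.mp h
  · intro A h
    rw [Finset.mem_powerset] at h
    simp [Finset.inter_eq_right.mpr h]

variable {R : Type*} [CommSemiring R]

/-- The convolution of set functions, a sum over the decompositions of a set into two disjoint
subsets: the product of the corresponding exponential generating functions. -/
def conv (f g : Finset ι → R) (H : Finset ι) : R :=
  ∑ A ∈ H.powerset, f A * g (H \ A)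

theorem conv_comm (f g : Finset ι → R) : conv f g = conv g f := by
  funext H
  unfold conv
  rw [sum_powerset_sdiff H (fun A B => f A * g B)]
  exact Finset.sum_congr rfl fun _ _ => mul_comm _ _

theorem conv_assoc (f g k : Finset ι → R) : conv (conv f g) k = conv f (conv g k) := by
  funext H
  unfold conv
  simp only [Finset.mul_sum, Finset.sum_mul]
  rw [sum_powerset_sdiff_comm H (fun A C => f A * (g C * k ((H \ A) \ C)))]
  refine Finset.sum_congr rfl fun D _ => Finset.sum_congr rfl fun A hA => ?_
  rw [Finset.mem_powerset] at hA
  rw [sdiff_sdiff_left, Finset.sup_eq_union, Finset.union_sdiff_of_subset hA, mul_assoc]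

theorem add_conv (f f' g : Finset ι → R) : conv (f + f') g = conv f g + conv f' g := by
  funext H
  simp [conv, add_mul, Finset.sum_add_distrib]

theorem conv_eq_add_sum_ssubsets (f g : Finset ι → R) (H : Finset ι) :
    conv f g H = f H * g ∅ + ∑ A ∈ H.ssubsets, f A * g (H \ A) := by
  unfold conv
  rw [← Finset.insert_erase (Finset.mem_powerset_self H),
    Finset.sum_insert (Finset.notMem_erase _ _), Finset.sdiff_self]
  rfl

theorem conv_right_cancel {R : Type*} [CommRing R] {f g u : Finset ι → R} (hu : u ∅ = 1)
    {H : Finset ι} (h : ∀ B ⊆ H, conv f u B = conv g u B) : ∀ B ⊆ H, f B = g B := by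
  intro B
  induction B using Finset.strongInduction with
  | H B ih =>
    intro hB
    have := h B hB
    rw [conv_eq_add_sum_ssubsets, conv_eq_add_sum_ssubsets, hu, mul_one, mul_one] at this
    rw [Finset.sum_congr rfl fun A hA => by
      rw [ih A (Finset.mem_ssubsets.mp hA) ((Finset.mem_ssubsets.mp hA).subset.trans hB)]] at this
    exact add_right_cancel this

/-- The restriction of a set function to the sets that contain `h`. -/
def pointed (h : ι) (f : Finset ι → R) (A : Finset ι) : R := if h ∈ A then f A else 0

theorem pointed_conv (h : ι) (f g : Finset ι → R) :
    pointed h (conv f g) = conv (pointed h f) g + conv f (pointed h g) := by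
  funext H
  simp only [Pi.add_apply, conv, pointed, ← Finset.sum_add_distrib]
  split_ifs with hH
  · refine Finset.sum_congr rfl fun A _ => ?_
    by_cases hA : h ∈ A <;> simp [hA, hH]
  · refine (Finset.sum_eq_zero fun A hA => ?_).symm
    have : h ∉ A := fun hh => hH (Finset.mem_powerset.mp hA hh)
    simp [this, hH]

end Convolution

section Logarithm

variable {ι : Type*} [DecidableEq ι]

section CommSemiring

variable {R : Type*} [CommSemiring R]

/-- The exponential of a set function, inverse to the passage to cumulants. -/
def setExp (f : Finset ι → R) (H : Finset ι) : R :=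
  ∑ p : Finpartition H, ∏ B ∈ p.parts, f B

theorem setExp_empty (f : Finset ι → R) : setExp f ∅ = 1 := by
  change ∑ p : Finpartition (⊥ : Finset ι), ∏ B ∈ p.parts, f B = 1
  rw [Fintype.sum_unique, Finpartition.parts_eq_empty_iff.mpr rfl, Finset.prod_empty]

theorem parts_avoid_of_mem {H A : Finset ι} (p : Finpartition H) (hA : A ∈ p.parts) :
    (p.avoid A).parts = p.parts.erase A := by
  have sdiff_eq {B : Finset ι} (hB : B ∈ p.parts) (hBA : B ≠ A) : B \ A = B :=
    Finset.sdiff_eq_self_of_disjoint (p.disjoint hB hA hBA)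
  ext B
  rw [Finpartition.mem_avoid, Finset.mem_erase]
  constructor
  · rintro ⟨C, hC, hCA, rfl⟩
    have hne : C ≠ A := fun h => hCA h.le
    rw [sdiff_eq hC hne]
    exact ⟨hne, hC⟩
  · rintro ⟨hBA, hB⟩
    refine ⟨B, hB, fun hle => ?_, sdiff_eq hB hBA⟩
    exact p.ne_bot hB ((p.disjoint hB hA hBA).eq_bot_of_le hle)

theorem sum_prod_parts_of_mem (f : Finset ι → R) {H A : Finset ι} (hA : A.Nonempty)
    (hAH : A ⊆ H) :
    ∑ p : Finpartition H with A ∈ p.parts, ∏ B ∈ p.parts, f B = f A * setExp f (H \ A) := by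
  have notMem (q : Finpartition (H \ A)) : A ∉ q.parts := fun hAq =>
    hA.ne_empty (Finset.disjoint_self_iff_empty A |>.mp
      (Finset.disjoint_of_subset_left (q.subset hAq) Finset.sdiff_disjoint))
  rw [setExp, Finset.mul_sum]
  refine Finset.sum_nbij' (fun p => p.avoid A)
    (fun q => q.extend hA.ne_empty Finset.sdiff_disjoint (Finset.sdiff_union_of_subset hAH))
    ?_ ?_ ?_ ?_ ?_
  · exact fun _ _ => Finset.mem_univ _
  · simp
  · intro p hp
    rw [Finset.mem_filter_univ] at hp
    ext1
    rw [Finpartition.extend_parts, parts_avoid_of_mem p hp, Finset.insert_erase hp]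
  · intro q _
    ext1
    rw [parts_avoid_of_mem _ (by simp), Finpartition.extend_parts,
      Finset.erase_insert (notMem q)]
  · intro p hp
    rw [Finset.mem_filter_univ] at hp
    rw [parts_avoid_of_mem p hp, Finset.mul_prod_erase _ _ hp]

theorem conv_pointed_setExp (f : Finset ι → R) {H : Finset ι} {h : ι} (hh : h ∈ H) :
    conv (pointed h f) (setExp f) H = setExp f H := by
  rw [setExp, ← Finset.sum_fiberwise_of_maps_to (g := fun p : Finpartition H => p.part h)
    (t := H.powerset) fun p _ => Finset.mem_powerset.mpr (p.part_subset h)]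
  refine Finset.sum_congr rfl fun A hA => ?_
  by_cases hhA : h ∈ A
  · rw [pointed, if_pos hhA,
      ← sum_prod_parts_of_mem f ⟨h, hhA⟩ (Finset.mem_powerset.mp hA)]
    refine Finset.sum_congr (Finset.filter_congr fun p _ => ⟨fun hp => ?_, ?_⟩) fun _ _ => rfl
    · exact p.part_eq_of_mem hp hhA
    · rintro rfl
      exact p.part_mem.mpr hh
  · rw [pointed, if_neg hhA, zero_mul, Finset.filter_false_of_mem, Finset.sum_empty]
    rintro p - rfl
    exact hhA (p.mem_part_self.mpr hh)

theorem parts_restrict_bind {H : Finset ι} (p : Finpartition H)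
    (q : ∀ B ∈ p.parts, Finpartition B) {B : Finset ι} (hB : B ∈ p.parts) :
    (p.bind q).restrict (p.le hB) = q B hB := by
  ext C
  simp only [Finpartition.restrict, Finset.mem_erase, Finset.mem_image,
    Finpartition.mem_bind]
  constructor
  · rintro ⟨hC, D, ⟨A, hA, hD⟩, rfl⟩
    obtain rfl : A = B := by
      by_contra hAB
      refine hC (Disjoint.eq_bot (Finset.disjoint_of_subset_left ((q A hA).subset hD) ?_))
      exact p.disjoint hA hB hAB
    rwa [inf_eq_left.mpr ((q A hA).le hD)]
  · exact fun hC => ⟨(q B hB).ne_bot hC, C, ⟨B, hB, hC⟩, inf_eq_left.mpr ((q B hB).le hC)⟩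

theorem bind_restrict_of_le {H : Finset ι} {p q : Finpartition H} (hqp : q ≤ p) :
    (p.bind fun _ hB => q.restrict (p.le hB)) = q := by
  ext C
  simp only [Finpartition.mem_bind, Finpartition.restrict,
    Finset.mem_erase, Finset.mem_image]
  constructor
  · rintro ⟨B, hB, hC, D, hD, rfl⟩
    obtain ⟨A, hA, hDA⟩ := hqp hD
    obtain rfl : A = B := by
      by_contra hAB
      exact hC (Disjoint.eq_bot (Finset.disjoint_of_subset_left hDA (p.disjoint hA hB hAB)))
    rwa [inf_eq_left.mpr hDA]
  · intro hC
    obtain ⟨B, hB, hCB⟩ := hqp hC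
    exact ⟨B, hB, q.ne_bot hC, C, hC, inf_eq_left.mpr hCB⟩

theorem prod_parts_bind (f : Finset ι → R) {H : Finset ι} (p : Finpartition H)
    (q : ∀ B ∈ p.parts, Finpartition B) :
    ∏ C ∈ (p.bind q).parts, f C = ∏ B ∈ p.parts.attach, ∏ C ∈ (q B.1 B.2).parts, f C := by
  refine Finset.prod_biUnion fun A _ B _ hAB => Finset.disjoint_left.mpr fun C hCA hCB => ?_
  have hdisj : Disjoint A.1 B.1 := p.disjoint A.2 B.2 (Subtype.coe_injective.ne hAB)
  exact (q _ _).ne_bot hCA (disjoint_self.mp (hdisj.mono ((q _ _).le hCA) ((q _ _).le hCB)))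

open Classical in
theorem prod_setExp (f : Finset ι → R) {H : Finset ι} (p : Finpartition H) :
    ∏ B ∈ p.parts, setExp f B =
      ∑ q : Finpartition H with q ≤ p, ∏ C ∈ q.parts, f C := by
  unfold setExp
  rw [Finset.prod_sum]
  refine Finset.sum_bij' (fun q _ => p.bind q) (fun q _ _ hB => q.restrict (p.le hB))
    ?_ ?_ ?_ ?_ ?_
  · intro q _
    rw [Finset.mem_filter_univ]
    intro C hC
    obtain ⟨B, hB, hCB⟩ := Finpartition.mem_bind.mp hC
    exact ⟨B, hB, (q B hB).le hCB⟩
  · exact fun _ _ => Finset.mem_pi.mpr fun _ _ => Finset.mem_univ _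
  · exact fun q _ => funext₂ fun B hB => parts_restrict_bind p q hB
  · exact fun q hq => bind_restrict_of_le (Finset.mem_filter_univ q |>.mp hq)
  · exact fun q _ => (prod_parts_bind f p q).symm

end CommSemiring

variable {R : Type*} [CommRing R]

theorem parts_top_eq {H : Finset ι} (hH : H.Nonempty) :
    (⊤ : Finpartition H).parts = {H} :=
  ((⊤ : Finpartition H).parts_nonempty hH.ne_empty).subset_singleton_iff.mp
    (Finpartition.parts_top_subset H)

theorem cumulant_setExp (f : Finset ι → R) {H : Finset ι} (hH : H.Nonempty) :
    cumulant (setExp f) H = f H := by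
  classical
  let : LocallyFiniteOrder (Finpartition H) := Fintype.toLocallyFiniteOrder
  have moebius_inversion (q : Finpartition H) :
      ∑ p with q ≤ p, (moebiusTop p : R) = if q = ⊤ then 1 else 0 := by
    have hIcc : ({p | q ≤ p} : Finset (Finpartition H)) = Finset.Icc q ⊤ := by ext; simp
    rw [hIcc, ← Int.cast_sum]
    have := IncidenceAlgebra.sum_Icc_mu_left (𝕜 := ℤ) q ⊤
    unfold moebiusTop
    rw [this]
    push_cast
    rfl
  calc cumulant (setExp f) H
      = ∑ p : Finpartition H, ∑ q with q ≤ p, (moebiusTop p : R) * ∏ C ∈ q.parts, f C := by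
        simp only [cumulant, prod_setExp, Finset.mul_sum]
    _ = ∑ q : Finpartition H, (∑ p with q ≤ p, (moebiusTop p : R)) * ∏ C ∈ q.parts, f C := by
        simp only [Finset.sum_mul]
        exact Finset.sum_comm' (by simp)
    _ = f H := by
        simp [moebius_inversion, parts_top_eq hH]

theorem ssubset_of_mem_parts {H B : Finset ι} {p : Finpartition H} (hp : p ≠ ⊤)
    (hB : B ∈ p.parts) : B ⊂ H := by
  refine (p.subset hB).ssubset_of_ne ?_
  rintro rfl
  exact hp (top_unique fun C _ => ⟨B, hB, (⊤ : Finpartition B).le ‹_›⟩)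

theorem exists_setExp_eq {u : Finset ι → R} (hu : u ∅ = 1) : ∃ f, setExp f = u := by
  obtain ⟨f, hf⟩ : ∃ f : Finset ι → R, ∀ H,
      f H = u H - ∑ p : {p : Finpartition H // p ≠ ⊤}, ∏ B ∈ p.1.parts, f B := by
    refine ⟨Finset.strongInduction fun H f => u H - ∑ p : {p : Finpartition H // p ≠ ⊤},
      ∏ B ∈ p.1.parts.attach, f B (ssubset_of_mem_parts p.2 B.2), fun H => ?_⟩
    refine (Finset.strongInduction_eq _ H).trans (congrArg (u H - ·) ?_)
    exact Finset.sum_congr rfl fun p _ => Finset.prod_attach p.1.parts _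
  refine ⟨f, funext fun H => ?_⟩
  obtain rfl | hH := H.eq_empty_or_nonempty
  · rw [setExp_empty, hu]
  · rw [setExp, Fintype.sum_eq_add_sum_subtype_ne _ ⊤, parts_top_eq hH, Finset.prod_singleton,
      hf H, sub_add_cancel]

theorem conv_pointed_cumulant_eq_pointed {u : Finset ι → R} (hu : u ∅ = 1) (h : ι) :
    conv (pointed h (cumulant u)) u = pointed h u := by
  obtain ⟨f, rfl⟩ := exists_setExp_eq hu
  have hpointed : pointed h (cumulant (setExp f)) = pointed h f := by
    funext A
    unfold pointed
    split_ifs with hA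
    exacts [cumulant_setExp f ⟨h, hA⟩, rfl]
  rw [hpointed]
  funext H
  by_cases hH : h ∈ H
  · rw [conv_pointed_setExp f hH, pointed, if_pos hH]
  · rw [pointed, if_neg hH]
    refine Finset.sum_eq_zero fun A hA => ?_
    rw [pointed, if_neg fun hhA => hH (Finset.mem_powerset.mp hA hhA), zero_mul]

theorem cumulant_eq_sub {u : Finset ι → R} (hu : u ∅ = 1) {H : Finset ι} {h : ι} (hh : h ∈ H) :
    cumulant u H = u H - ∑ A ∈ H.ssubsets with h ∈ A, cumulant u A * u (H \ A) := by
  have hH := congrFun (conv_pointed_cumulant_eq_pointed hu h) H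
  rw [conv_eq_add_sum_ssubsets, hu, mul_one, pointed, pointed, if_pos hh, if_pos hh] at hH
  rw [← hH, Finset.sum_filter]
  simp [pointed, ite_mul]

end Logarithm

section Evolution

variable {ι : Type*} [DecidableEq ι] {R S : Type*} [CommRing R] [CommRing S]

/-- The cumulants, with the value at the empty set replaced by `0`: the logarithm of a set
function with respect to `conv`. -/
def reducedCumulant (u : Finset ι → R) (H : Finset ι) : R := if H = ∅ then 0 else cumulant u H

theorem pointed_reducedCumulant (u : Finset ι → R) (h : ι) :
    pointed h (reducedCumulant u) = pointed h (cumulant u) := by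
  funext A
  unfold pointed reducedCumulant
  split_ifs with hhA hA
  · exact absurd hhA (hA ▸ Finset.notMem_empty h)
  all_goals rfl

theorem map_pointed {F : Finset ι → R →+ S} (f : Finset ι → R) (h : ι) :
    (fun A => F A (pointed h f A)) = pointed h fun A => F A (f A) := by
  funext A
  exact apply_ite (F A) (h ∈ A) (f A) 0 |>.trans (by rw [map_zero, pointed])

theorem eq_of_pointed_eq_add_conv {g : ι → Finset ι → R} {k v w : Finset ι → R}
    (hempty : v ∅ = w ∅) (hv : ∀ h, pointed h v = g h + conv (pointed h k) v)
    (hw : ∀ h, pointed h w = g h + conv (pointed h k) w) : v = w := by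
  funext H
  induction H using Finset.strongInduction with
  | H H ih =>
    obtain rfl | ⟨h, hh⟩ := H.eq_empty_or_nonempty
    · exact hempty
    have hvH := congrFun (hv h) H
    have hwH := congrFun (hw h) H
    rw [pointed, if_pos hh] at hvH hwH
    rw [hvH, hwH]
    refine congrArg (g h H + ·) (Finset.sum_congr rfl fun A hA => ?_)
    by_cases hhA : h ∈ A
    · rw [ih _ (Finset.sdiff_ssubset (Finset.mem_powerset.mp hA) ⟨h, hhA⟩)]
    · rw [pointed, if_neg hhA, zero_mul, zero_mul]

theorem gradedDerivation_conv {d : Finset ι → R →+ R}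
    (hd : ∀ B C, Disjoint B C → ∀ x y, d (B ∪ C) (x * y) = d B x * y + x * d C y)
    (f g : Finset ι → R) :
    (fun H => d H (conv f g H)) = conv (fun H => d H (f H)) g + conv f (fun H => d H (g H)) := by
  funext H
  simp only [Pi.add_apply, conv, map_sum, ← Finset.sum_add_distrib]
  refine Finset.sum_congr rfl fun A hA => ?_
  rw [← hd _ _ Finset.disjoint_sdiff, Finset.union_sdiff_of_subset (Finset.mem_powerset.mp hA)]

theorem gradedDerivation_eq_conv {d : Finset ι → R →+ R}
    (hd : ∀ B C, Disjoint B C → ∀ x y, d (B ∪ C) (x * y) = d B x * y + x * d C y)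
    {u : Finset ι → R} (hu : u ∅ = 1) :
    (fun H => d H (u H)) = conv (fun H => d H (reducedCumulant u H)) u := by
  set dk : Finset ι → R := fun H => d H (reducedCumulant u H) with hdk
  have hlog (h : ι) : conv (pointed h (reducedCumulant u)) u = pointed h u := by
    rw [pointed_reducedCumulant, conv_pointed_cumulant_eq_pointed hu]
  refine eq_of_pointed_eq_add_conv (g := fun h => conv (pointed h dk) u)
    (k := reducedCumulant u) ?_ (fun h => ?_) fun h => ?_
  · have hone : d ∅ 1 = 0 := by simpa using hd ∅ ∅ (Finset.disjoint_empty_left _) 1 1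
    simp [conv, hdk, reducedCumulant, hu, hone]
  · rw [← map_pointed, ← hlog, gradedDerivation_conv hd, map_pointed]
  · rw [pointed_conv, ← hlog, ← conv_assoc, conv_comm dk, conv_assoc]

theorem sum_bracket_eq_conv {Γ : Finset ι → Finset ι → R →+ R →+ R}
    (hΓ : ∀ A B C, Disjoint B C → ∀ f g k,
      Γ A (B ∪ C) f (g * k) = Γ A B f g * k + g * Γ A C f k)
    (f : Finset ι → R) {u : Finset ι → R} (hu : u ∅ = 1) (H : Finset ι) :
    ∑ A ∈ H.powerset, Γ A (H \ A) (f A) (u (H \ A)) =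
      conv (fun D => ∑ A ∈ D.powerset, Γ A (D \ A) (f A) (reducedCumulant u (D \ A))) u H := by
  have hlog (A B : Finset ι) : Γ A B (f A) (u B) =
      ∑ C ∈ B.powerset, Γ A C (f A) (reducedCumulant u C) * u (B \ C) :=
    congrFun (gradedDerivation_eq_conv (d := fun C => Γ A C (f A))
      (fun B C hBC x y => hΓ A B C hBC (f A) x y) hu) B
  simp only [hlog, conv, Finset.sum_mul]
  rw [sum_powerset_sdiff_comm H fun A C =>
    Γ A C (f A) (reducedCumulant u C) * u ((H \ A) \ C)]
  refine Finset.sum_congr rfl fun D _ => Finset.sum_congr rfl fun A hA => ?_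
  rw [sdiff_sdiff_left, Finset.sup_eq_union,
    Finset.union_sdiff_of_subset (Finset.mem_powerset.mp hA)]

theorem secondOrder_conv {φ : R →+* S} {T : Finset ι → R →+ S}
    {Γ : Finset ι → Finset ι → R →+ R →+ R} {c : R}
    (hT : ∀ A B, Disjoint A B → ∀ f g,
      T (A ∪ B) (f * g) = T A f * φ g + φ f * T B g + φ (c * Γ A B f g))
    (f : Finset ι → R) {g : Finset ι → R} (hg : ∀ H, T H (g H) = 0) (H : Finset ι) :
    T H (conv f g H) = conv (fun A => T A (f A)) (φ ∘ g) H +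
      φ (c * ∑ A ∈ H.powerset, Γ A (H \ A) (f A) (g (H \ A))) := by
  simp only [conv, map_sum, Finset.mul_sum, ← Finset.sum_add_distrib]
  refine Finset.sum_congr rfl fun A hA => ?_
  have hTA := hT A (H \ A) Finset.disjoint_sdiff (f A) (g (H \ A))
  rwa [Finset.union_sdiff_of_subset (Finset.mem_powerset.mp hA), hg, mul_zero, add_zero] at hTA

theorem secondOrder_cumulant {φ : R →+* S} {T : Finset ι → R →+ S}
    {Γ : Finset ι → Finset ι → R →+ R →+ R} {c : R}
    (hT : ∀ A B, Disjoint A B → ∀ f g,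
      T (A ∪ B) (f * g) = T A f * φ g + φ f * T B g + φ (c * Γ A B f g))
    (hΓ : ∀ A B C, Disjoint B C → ∀ f g k,
      Γ A (B ∪ C) f (g * k) = Γ A B f g * k + g * Γ A C f k)
    {u : Finset ι → R} (hu : u ∅ = 1) (hTu : ∀ H, T H (u H) = 0) {H : Finset ι} {h : ι}
    (hh : h ∈ H) :
    T H (cumulant u H) = -φ (c * ∑ A ∈ H.powerset,
      Γ A (H \ A) (pointed h (cumulant u) A) (reducedCumulant u (H \ A))) := by
  set κ := pointed h (cumulant u)
  set E : Finset ι → R := fun D =>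
    ∑ A ∈ D.powerset, Γ A (D \ A) (κ A) (reducedCumulant u (D \ A))
  have hconv (B : Finset ι) :
      conv (fun A => T A (κ A) + φ (c * E A)) (φ ∘ u) B = conv 0 (φ ∘ u) B := by
    have hTκ : T B (conv κ u B) = 0 := by
      rw [conv_pointed_cumulant_eq_pointed hu, ← hTu B]
      unfold pointed
      split_ifs
      exacts [rfl, by rw [map_zero, hTu]]
    rw [secondOrder_conv hT _ hTu, sum_bracket_eq_conv hΓ _ hu] at hTκ
    calc conv (fun A => T A (κ A) + φ (c * E A)) (φ ∘ u) B
        = conv (fun A => T A (κ A)) (φ ∘ u) B + φ (c * conv E u B) := by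
          simp [conv, add_mul, Finset.sum_add_distrib, Finset.mul_sum, mul_assoc]
      _ = conv 0 (φ ∘ u) B := by rw [hTκ]; simp [conv]
  have hH := conv_right_cancel (by simp [hu]) (fun B _ => hconv B) H subset_rfl
  have hκ : κ H = cumulant u H := if_pos hh
  rw [← hκ]
  exact eq_neg_of_add_eq_zero_left hH

end Evolution

section SmallCumulants

variable {ι : Type*}

section UnionConv

variable {R : Type*} [CommRing R]

theorem exists_sum_powerset_eq (v : Finset ι → R) :
    ∃ w : Finset ι → R, ∀ B, v B = ∑ A ∈ B.powerset, w A := by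
  classical
  let w : Finset ι → R := Finset.strongInduction fun B w =>
    v B - ∑ A ∈ B.ssubsets.attach, w A.1 (Finset.mem_ssubsets.mp A.2)
  refine ⟨w, fun B => ?_⟩
  have hw : w B = v B - ∑ A ∈ B.ssubsets.attach, w A.1 := Finset.strongInduction_eq _ _
  rw [Finset.sum_attach B.ssubsets w] at hw
  rw [← Finset.insert_erase (Finset.mem_powerset_self B),
    Finset.sum_insert (Finset.notMem_erase _ _), hw]
  exact (sub_add_cancel _ _).symm

theorem eq_of_sum_powerset_eq {f g : Finset ι → R}
    (h : ∀ B : Finset ι, ∑ A ∈ B.powerset, f A = ∑ A ∈ B.powerset, g A) : f = g := by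
  classical
  exact funext fun C => conv_right_cancel (u := fun _ => 1) rfl (H := C)
    (fun B _ => by simpa [conv] using h B) C subset_rfl

variable [DecidableEq ι]

/-- The product of set functions that summation over subsets turns into the pointwise product. -/
def unionConv (f g : Finset ι → R) (H : Finset ι) : R :=
  ∑ x ∈ H.powerset ×ˢ H.powerset with x.1 ∪ x.2 = H, f x.1 * g x.2

theorem sum_powerset_mul_sum_powerset (f g : Finset ι → R) (B : Finset ι) :
    (∑ A ∈ B.powerset, f A) * ∑ A ∈ B.powerset, g A = ∑ C ∈ B.powerset, unionConv f g C := by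
  rw [Finset.sum_mul_sum, ← Finset.sum_product',
    ← Finset.sum_fiberwise_of_maps_to (t := B.powerset) (g := fun x => x.1 ∪ x.2)]
  · refine Finset.sum_congr rfl fun C hC => Finset.sum_congr ?_ fun _ _ => rfl
    rw [Finset.mem_powerset] at hC
    ext ⟨A, A'⟩
    simp only [Finset.mem_filter, Finset.mem_product, Finset.mem_powerset]
    refine ⟨fun h => ⟨?_, h.2⟩, fun h => ⟨⟨h.1.1.trans hC, h.1.2.trans hC⟩, h.2⟩⟩
    exact ⟨h.2 ▸ Finset.subset_union_left, h.2 ▸ Finset.subset_union_right⟩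
  · intro x hx
    simp only [Finset.mem_product, Finset.mem_powerset] at hx ⊢
    exact Finset.union_subset hx.1 hx.2

theorem unionConv_eq_add_sum (f g : Finset ι → R) (H : Finset ι) :
    unionConv f g H = (∑ A ∈ H.powerset, f A) * g H +
      ∑ x ∈ H.powerset ×ˢ H.ssubsets with x.1 ∪ x.2 = H, f x.1 * g x.2 := by
  have hunion {A : Finset ι} (hA : A ∈ H.powerset) : A ∪ H = H :=
    Finset.union_eq_right.mpr (Finset.mem_powerset.mp hA)
  simp only [unionConv, Finset.sum_filter, Finset.sum_product, Finset.sum_mul,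
    ← Finset.sum_add_distrib]
  refine Finset.sum_congr rfl fun A hA => ?_
  rw [← Finset.insert_erase (Finset.mem_powerset_self H),
    Finset.sum_insert (Finset.notMem_erase _ _), if_pos (hunion hA)]
  rfl

end UnionConv

variable [DecidableEq ι] {A K : Type*} [CommRing A] [CommRing K] [Algebra A K] {M : Submodule A K}

theorem mul_mem_pow_of_le (hM : M ≤ 1) {k l m : ℕ} {x y : K} (hx : x ∈ M ^ k) (hy : y ∈ M ^ l)
    (h : m ≤ k + l) : x * y ∈ M ^ m :=
  pow_le_pow_right_of_le_one' hM h (pow_add M k l ▸ Submodule.mul_mem_mul hx hy)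

theorem mul_mem_pow_card_union (hM : M ≤ 1) {x y : K} {B C : Finset ι} (hx : x ∈ M ^ B.card)
    (hy : y ∈ M ^ C.card) : x * y ∈ M ^ (B ∪ C).card :=
  mul_mem_pow_of_le hM hx hy (Finset.card_union_le B C)

variable (ι) in
/-- The algebra of set functions whose iterated differences of order `k` lie in `M ^ k`: these
differences are the values `w B`, `B.card = k`. -/
def smallDifferences (hM : M ≤ 1) : Subalgebra A (Finset ι → K) where
  carrier := {v | ∃ w : Finset ι → K, (∀ B, w B ∈ M ^ B.card) ∧
    ∀ B, v B = ∑ C ∈ B.powerset, w C}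
  algebraMap_mem' c := by
    refine ⟨fun B => if B = ∅ then algebraMap A K c else 0, fun B => ?_, by simp⟩
    dsimp only
    split_ifs with hB
    · simp [hB]
    · exact zero_mem _
  add_mem' := by
    rintro v v' ⟨w, hw, hv⟩ ⟨w', hw', hv'⟩
    exact ⟨w + w', fun B => add_mem (hw B) (hw' B), fun B => by
      simp only [Pi.add_apply, hv, hv', Finset.sum_add_distrib]⟩
  mul_mem' := by
    rintro v v' ⟨w, hw, hv⟩ ⟨w', hw', hv'⟩
    refine ⟨unionConv w w', fun B => sum_mem fun x hx => ?_, fun B => by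
      rw [Pi.mul_apply, hv, hv', sum_powerset_mul_sum_powerset]⟩
    exact (Finset.mem_filter.mp hx).2 ▸ mul_mem_pow_card_union hM (hw x.1) (hw' x.2)

theorem sum_mem_smallDifferences (hM : M ≤ 1) {x : ι → K} (hx : ∀ i, x i ∈ M) :
    (fun B => ∑ i ∈ B, x i) ∈ smallDifferences ι hM := by
  refine ⟨fun B => if B.card = 1 then ∑ i ∈ B, x i else 0, fun B => ?_, fun B => ?_⟩
  · dsimp only
    split_ifs with hB
    · rw [hB, pow_one]
      exact sum_mem fun i _ => hx i
    · exact zero_mem _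
  · rw [← Finset.sum_filter, ← Finset.powersetCard_eq_filter, Finset.powersetCard_one,
      Finset.sum_map]
    simp

theorem mem_smallDifferences_of_mul_eq_one (hM : M ≤ 1) {v v' : Finset ι → K}
    (hv : v ∈ smallDifferences ι hM) (hvv' : v * v' = 1) (hv' : ∀ B, v' B ∈ (1 : Submodule A K)) :
    v' ∈ smallDifferences ι hM := by
  obtain ⟨w, hw, hvw⟩ := hv
  obtain ⟨w', hvw'⟩ := exists_sum_powerset_eq v'
  refine ⟨w', fun C => ?_, hvw'⟩
  have hunion : unionConv w w' = fun C => if C = ∅ then 1 else 0 :=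
    eq_of_sum_powerset_eq fun B => by
      rw [← sum_powerset_mul_sum_powerset, ← hvw, ← hvw', ← Pi.mul_apply, hvv']
      simp
  induction C using Finset.strongInduction with
  | H C ih =>
    have hC := congrFun hunion C
    rw [unionConv_eq_add_sum, ← hvw, ← eq_sub_iff_add_eq] at hC
    have hwC : w' C = v' C * (v C * w' C) := by
      rw [← mul_assoc, mul_comm (v' C), ← Pi.mul_apply, hvv', Pi.one_apply, one_mul]
    rw [hwC, hC, ← one_mul (M ^ C.card)]
    refine Submodule.mul_mem_mul (hv' C) (sub_mem ?_ (sum_mem fun x hx => ?_))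
    · split_ifs with hempty
      · simp [hempty, Submodule.one_le.mp]
      · exact zero_mem _
    · rw [Finset.mem_filter, Finset.mem_product, Finset.mem_ssubsets] at hx
      exact hx.2 ▸ mul_mem_pow_card_union hM (hw x.1) (ih x.2 hx.1.2)

theorem exists_conv_eq_of_cumulant_mem_pow (hM : M ≤ 1) {u : Finset ι → K} (hu : u ∅ = 1)
    {H : Finset ι} (hκ : ∀ D ⊆ H, D.Nonempty → cumulant u D ∈ M ^ (D.card - 1)) (B : Finset ι) :
    ∃ F : Finset ι → K, (∀ C ⊆ H, F C ∈ M ^ (C.card - B.card)) ∧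
      (fun C => if B ⊆ C then u C else 0) = conv F u := by
  induction B using Finset.induction_on with
  | empty =>
    refine ⟨fun C => if C = ∅ then 1 else 0, fun C _ => ?_, by funext; simp [conv]⟩
    dsimp only
    split_ifs with hC
    · simp [hC, Submodule.one_le.mp]
    · exact zero_mem _
  | insert b B hb ih =>
    obtain ⟨F, hF, hFu⟩ := ih
    refine ⟨pointed b F + conv F (pointed b (cumulant u)), fun C hC => ?_, ?_⟩
    · rw [Finset.card_insert_of_notMem hb]
      refine add_mem ?_ (sum_mem fun D hD => ?_)
      · unfold pointed
        split_ifs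
        · exact pow_le_pow_right_of_le_one' hM (by omega) (hF C hC)
        · exact zero_mem _
      · rw [Finset.mem_powerset] at hD
        unfold pointed
        split_ifs with hbD
        · refine mul_mem_pow_of_le hM (hF D (hD.trans hC))
            (hκ (C \ D) (Finset.sdiff_subset.trans hC) ⟨b, hbD⟩) ?_
          have := Finset.card_sdiff_add_card_eq_card hD
          omega
        · rw [mul_zero]
          exact zero_mem _
    · rw [add_conv, conv_assoc, conv_pointed_cumulant_eq_pointed hu, ← pointed_conv, ← hFu]
      funext C
      simp only [pointed, Finset.insert_subset_iff]
      split_ifs <;> simp_all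

theorem conv_cumulant_insert {u : Finset ι → K} (hu : u ∅ = 1) {h : ι} {B : Finset ι}
    (hh : h ∉ B) : conv (fun C => cumulant u (insert h C)) u B = u (insert h B) := by
  have hlog := congrFun (conv_pointed_cumulant_eq_pointed hu h) (insert h B)
  rw [pointed, if_pos (Finset.mem_insert_self h B)] at hlog
  have hzero : ∑ C ∈ B.powerset, pointed h (cumulant u) C * u (insert h B \ C) = 0 :=
    Finset.sum_eq_zero fun C hC => by
      rw [pointed, if_neg fun hhC => hh (Finset.mem_powerset.mp hC hhC), zero_mul]
  rw [← hlog, conv, conv, Finset.sum_powerset_insert hh, hzero, zero_add]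
  refine Finset.sum_congr rfl fun C _ => ?_
  rw [pointed, if_pos (Finset.mem_insert_self h C), Finset.insert_sdiff_insert,
    Finset.sdiff_insert_of_notMem hh]

theorem sum_mul_conv {κ : Type*} (s : Finset κ) (c : κ → K) (F : κ → Finset ι → K)
    (u : Finset ι → K) (B : Finset ι) :
    conv (fun C => ∑ k ∈ s, c k * F k C) u B = ∑ k ∈ s, c k * conv (F k) u B := by
  simp only [conv, Finset.sum_mul, Finset.mul_sum, mul_assoc]
  exact Finset.sum_comm

theorem cumulant_mem_pow_of_ratio (hM : M ≤ 1) {u : Finset ι → K} (hu : u ∅ = 1)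
    {v : ι → Finset ι → K} (hv : ∀ h, v h ∈ smallDifferences ι hM)
    (huv : ∀ h B, h ∉ B → u (insert h B) = v h B * u B) {H : Finset ι} (hH : H.Nonempty) :
    cumulant u H ∈ M ^ (H.card - 1) := by
  induction H using Finset.strongInduction with
  | H H ih =>
    obtain ⟨h, hh⟩ := hH
    obtain ⟨B₀, hhB₀, rfl⟩ : ∃ B₀, h ∉ B₀ ∧ insert h B₀ = H :=
      ⟨H.erase h, Finset.notMem_erase h H, Finset.insert_erase hh⟩
    obtain ⟨w, hw, hvw⟩ := hv h
    choose F hF hFu using exists_conv_eq_of_cumulant_mem_pow hM hu (H := B₀) fun D hD =>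
      ih D (hD.trans_ssubset (Finset.ssubset_insert hhB₀))
    have hconv : ∀ B ⊆ B₀, conv (fun C => cumulant u (insert h C)) u B =
        conv (fun C => ∑ A ∈ B₀.powerset, w A * F A C) u B := by
      intro B hB
      have hfilter : {A ∈ B₀.powerset | A ⊆ B} = B.powerset := by
        ext A
        simpa using fun hA : A ⊆ B => hA.trans hB
      have hhB : h ∉ B := fun hhB => hhB₀ (hB hhB)
      rw [conv_cumulant_insert hu hhB, sum_mul_conv, huv h B hhB, hvw, Finset.sum_mul]
      simp only [← hFu, mul_ite, mul_zero]
      rw [← Finset.sum_filter, hfilter]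
    rw [conv_right_cancel hu hconv B₀ subset_rfl, Finset.card_insert_of_notMem hhB₀,
      Nat.add_sub_cancel]
    exact sum_mem fun A _ => mul_mem_pow_of_le hM (hw A) (hF A B₀ subset_rfl) (by omega)

end SmallCumulants

/-! ### Hook polynomials -/

section Hook

theorem rowLen_eq_zero_iff {lam : YoungDiagram} {k : ℕ} :
    lam.rowLen k = 0 ↔ lam.colLen 0 ≤ k := by
  have h : 0 < lam.rowLen k ↔ k < lam.colLen 0 :=
    YoungDiagram.mem_iff_lt_rowLen.symm.trans YoungDiagram.mem_iff_lt_colLen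
  omega

theorem prod_cells {M : Type*} [CommMonoid M] {lam : YoungDiagram} {N : ℕ}
    (hN : lam.colLen 0 ≤ N) (f : ℕ × ℕ → M) :
    ∏ c ∈ lam.cells, f c = ∏ k ∈ Finset.range N, ∏ c ∈ Finset.range (lam.rowLen k), f (k, c) := by
  rw [Finset.prod_sigma']
  refine Finset.prod_nbij' (fun c => ⟨c.1, c.2⟩) (fun x => (x.1, x.2)) ?_ ?_ ?_ ?_ ?_
  · rintro ⟨i, j⟩ h
    have hmem : (i, j) ∈ lam := h
    have hfirst : (i, 0) ∈ lam := lam.up_left_mem le_rfl (Nat.zero_le _) hmem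
    simp only [Finset.mem_sigma, Finset.mem_range]
    exact ⟨(YoungDiagram.mem_iff_lt_colLen.mp hfirst).trans_le hN,
      YoungDiagram.mem_iff_lt_rowLen.mp hmem⟩
  · rintro ⟨i, j⟩ h
    simp only [Finset.mem_sigma, Finset.mem_range] at h
    exact (YoungDiagram.mem_cells _).mpr (YoungDiagram.mem_iff_lt_rowLen.mpr h.2)
  · intro _ _; rfl
  · intro _ _; rfl
  · intro _ _; rfl

theorem prod_Ico_antitone {M : Type*} [CommMonoid M] {a : ℕ → ℕ} (ha : Antitone a) (f : ℕ → M)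
    {k N : ℕ} (h : k ≤ N) : ∏ c ∈ Finset.Ico (a N) (a k), f c =
      ∏ i ∈ Finset.Ico k N, ∏ c ∈ Finset.Ico (a (i + 1)) (a i), f c := by
  induction N, h using Nat.le_induction with
  | base => simp
  | succ N hkN ih =>
    rw [Finset.prod_Ico_succ_top hkN, ← ih, mul_comm,
      Finset.prod_Ico_consecutive _ (ha (Nat.le_succ N)) (ha hkN)]

/-- The product `∏_{s < m} (c + α (n + s))`: the contribution to a hook polynomial of `m` adjacent
boxes of a row, of leg `c - 1` and of arms `n, …, n + m - 1`. -/
def risingProduct (c n m : ℕ) : QAlpha :=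
  ∏ s ∈ Finset.range m, ((c : QAlpha) + alpha * ((n + s : ℕ) : QAlpha))

theorem risingProduct_add (c n a b : ℕ) :
    risingProduct c n (a + b) = risingProduct c n a * risingProduct c (n + a) b := by
  simp only [risingProduct, Finset.prod_range_add, add_assoc]

theorem risingProduct_ne_zero {c : ℕ} (hc : c ≠ 0) (n m : ℕ) : risingProduct c n m ≠ 0 :=
  Finset.prod_ne_zero_iff.mpr fun s _ => by
    exact_mod_cast intCast_add_alpha_mul_ne_zero (Int.natCast_ne_zero.mpr hc) (n + s)

theorem inv_risingProduct_mem_regularAtZero {c : ℕ} (hc : c ≠ 0) (n m : ℕ) :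
    (risingProduct c n m)⁻¹ ∈ regularAtZero := by
  rw [risingProduct, ← Finset.prod_inv_distrib]
  refine prod_mem fun s _ => ?_
  exact_mod_cast
    inv_intCast_add_alpha_mul_mem_regularAtZero (Int.natCast_ne_zero.mpr hc) (n + s)

theorem risingProduct_add_add {c : ℕ} (hc : c ≠ 0) (n n' m m' : ℕ) :
    risingProduct c (n + n') (m + m') =
      risingProduct c (n + m) (n' + m') * (risingProduct c n n')⁻¹ * risingProduct c n m := by
  have h : risingProduct c n n' * risingProduct c (n + n') (m + m') =
      risingProduct c n m * risingProduct c (n + m) (n' + m') := by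
    rw [← risingProduct_add, ← risingProduct_add]
    congr 1
    omega
  have h0 := risingProduct_ne_zero hc n n'
  field_simp
  linear_combination h

theorem risingProduct_mem_smallDifferences {ι : Type*} [DecidableEq ι] (c m : ℕ) (n : ι → ℕ) :
    (fun B => risingProduct c (∑ i ∈ B, n i) m) ∈ smallDifferences ι alphaIdeal_le_one := by
  have hfactor (s : ℕ) : (fun B : Finset ι => (c : QAlpha) + alpha * ((∑ i ∈ B, n i) + s : ℕ)) ∈
      smallDifferences ι alphaIdeal_le_one := by
    have hsum := sum_mem_smallDifferences alphaIdeal_le_one fun i =>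
      alphaIdeal.smul_mem (n i : regularAtZero) alpha_mem_alphaIdeal
    have hconst : (c : QAlpha) + alpha * s ∈ regularAtZero :=
      add_mem (natCast_mem _ c) (mul_mem alpha_mem_regularAtZero (natCast_mem _ s))
    convert add_mem ((smallDifferences ι alphaIdeal_le_one).algebraMap_mem ⟨_, hconst⟩) hsum
      using 1
    funext B
    change _ = (c : QAlpha) + alpha * s + ∑ i ∈ B, (n i : QAlpha) * alpha
    push_cast
    rw [← Finset.sum_mul]
    ring
  convert prod_mem (t := Finset.range m) fun s _ => hfactor s using 1
  funext B
  simp [risingProduct]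

-- In row `k`, the boxes of leg `i - k` are those in columns `lam_{i+1} ≤ c < lam_i`.
theorem hook_eq_prod_risingProduct {lam : YoungDiagram} {N : ℕ} (hN : lam.colLen 0 ≤ N) :
    hook lam = ∏ k ∈ Finset.range N, ∏ i ∈ Finset.Ico k N,
      risingProduct (i - k + 1) (lam.rowLen k - lam.rowLen i)
        (lam.rowLen i - lam.rowLen (i + 1)) := by
  rw [hook, prod_cells hN]
  refine Finset.prod_congr rfl fun k hk => ?_
  rw [Finset.mem_range] at hk
  have hanti : Antitone lam.rowLen := fun i j h => lam.rowLen_anti i j h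
  rw [Finset.range_eq_Ico, ← rowLen_eq_zero_iff.mpr hN, prod_Ico_antitone hanti _ hk.le]
  refine Finset.prod_congr rfl fun i hi => ?_
  rw [Finset.mem_Ico] at hi
  have hi1 := hanti (Nat.le_succ i)
  have hki := hanti hi.1
  rw [risingProduct, Finset.prod_Ico_eq_prod_range, ← Finset.prod_range_reflect]
  refine Finset.prod_congr rfl fun s hs => ?_
  rw [Finset.mem_range] at hs
  simp only [Nat.succ_eq_add_one] at hi1
  set c := lam.rowLen (i + 1) + (lam.rowLen i - lam.rowLen (i + 1) - 1 - s)
  have hlt : i < lam.colLen c := YoungDiagram.mem_iff_lt_colLen.mp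
    (YoungDiagram.mem_iff_lt_rowLen.mpr (by omega))
  have hge : ¬ i + 1 < lam.colLen c := fun h => by
    have := YoungDiagram.mem_iff_lt_rowLen.mp (YoungDiagram.mem_iff_lt_colLen.mpr h)
    omega
  have hleg : lam.colLen c - (k + 1) = i - k := by omega
  have harm : lam.rowLen k - (c + 1) = lam.rowLen k - lam.rowLen i + s := by omega
  rw [hleg, harm]
  push_cast
  ring

theorem colLen_entrywiseSum_le {ι : Type*} {lam : ι → YoungDiagram} {N : ℕ} {B : Finset ι}
    (hN : ∀ i ∈ B, (lam i).colLen 0 ≤ N) : (entrywiseSum lam B).colLen 0 ≤ N := by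
  rw [← rowLen_eq_zero_iff, rowLen_entrywiseSum]
  exact Finset.sum_eq_zero fun i hi => rowLen_eq_zero_iff.mpr (hN i hi)

theorem entrywiseSum_empty {ι : Type*} (lam : ι → YoungDiagram) : entrywiseSum lam ∅ = ⊥ := by
  ext c
  simp [entrywiseSum]

theorem hook_bot : hook ⊥ = 1 := by
  simp [hook]

theorem hook_entrywiseSum {ι : Type*} {lam : ι → YoungDiagram} {N : ℕ} {B : Finset ι}
    (hN : ∀ i ∈ B, (lam i).colLen 0 ≤ N) : hook (entrywiseSum lam B) =
      ∏ k ∈ Finset.range N, ∏ i ∈ Finset.Ico k N, risingProduct (i - k + 1)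
        (∑ j ∈ B, ((lam j).rowLen k - (lam j).rowLen i))
        (∑ j ∈ B, ((lam j).rowLen i - (lam j).rowLen (i + 1))) := by
  rw [hook_eq_prod_risingProduct (colLen_entrywiseSum_le hN)]
  refine Finset.prod_congr rfl fun k _ => Finset.prod_congr rfl fun i hi => ?_
  simp only [rowLen_entrywiseSum]
  rw [Finset.sum_tsub_distrib _ fun j _ => (lam j).rowLen_anti _ _ (Finset.mem_Ico.mp hi).1,
    Finset.sum_tsub_distrib _ fun j _ => (lam j).rowLen_anti _ _ i.le_succ]

/-- The factor by which the hook polynomial of `entrywiseSum lam B` grows when `h ∉ B` joins `B`,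
for partitions with at most `N` parts. -/
def hookRatio {ι : Type*} (lam : ι → YoungDiagram) (N : ℕ) (h : ι) (B : Finset ι) : QAlpha :=
  ∏ k ∈ Finset.range N, ∏ i ∈ Finset.Ico k N,
    risingProduct (i - k + 1)
      (∑ j ∈ B, (((lam j).rowLen k - (lam j).rowLen i) +
        ((lam j).rowLen i - (lam j).rowLen (i + 1))))
      (((lam h).rowLen k - (lam h).rowLen i) + ((lam h).rowLen i - (lam h).rowLen (i + 1))) *
    (risingProduct (i - k + 1) (∑ j ∈ B, ((lam j).rowLen k - (lam j).rowLen i))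
      ((lam h).rowLen k - (lam h).rowLen i))⁻¹

theorem hook_entrywiseSum_insert {ι : Type*} [DecidableEq ι] {lam : ι → YoungDiagram} {N : ℕ}
    {h : ι} {B : Finset ι} (hN : ∀ i ∈ insert h B, (lam i).colLen 0 ≤ N) (hB : h ∉ B) :
    hook (entrywiseSum lam (insert h B)) = hookRatio lam N h B * hook (entrywiseSum lam B) := by
  rw [hook_entrywiseSum hN, hook_entrywiseSum fun i hi => hN i (Finset.mem_insert_of_mem hi)]
  simp only [hookRatio, ← Finset.prod_mul_distrib, Finset.sum_insert hB]
  refine Finset.prod_congr rfl fun k _ => Finset.prod_congr rfl fun i _ => ?_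
  rw [Finset.sum_add_distrib, ← risingProduct_add_add (Nat.succ_ne_zero _)]
  congr 1 <;> exact add_comm _ _

theorem hookRatio_mem_smallDifferences {ι : Type*} [DecidableEq ι] (lam : ι → YoungDiagram)
    (N : ℕ) (h : ι) : hookRatio lam N h ∈ smallDifferences ι alphaIdeal_le_one := by
  have hinv (c m : ℕ) (n : ι → ℕ) : (fun B => (risingProduct (c + 1) (∑ i ∈ B, n i) m)⁻¹) ∈
      smallDifferences ι alphaIdeal_le_one :=
    mem_smallDifferences_of_mul_eq_one alphaIdeal_le_one
      (risingProduct_mem_smallDifferences (c + 1) m n)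
      (funext fun _ => mul_inv_cancel₀ (risingProduct_ne_zero c.succ_ne_zero _ _))
      fun _ => Submodule.mem_one.mpr
        ⟨⟨_, inv_risingProduct_mem_regularAtZero c.succ_ne_zero _ _⟩, rfl⟩
  convert prod_mem (t := Finset.range N) fun k _ => prod_mem (t := Finset.Ico k N) fun i _ =>
    mul_mem (risingProduct_mem_smallDifferences (i - k + 1)
      (((lam h).rowLen k - (lam h).rowLen i) + ((lam h).rowLen i - (lam h).rowLen (i + 1)))
      fun j => ((lam j).rowLen k - (lam j).rowLen i) +
        ((lam j).rowLen i - (lam j).rowLen (i + 1)))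
    (hinv (i - k) ((lam h).rowLen k - (lam h).rowLen i)
      fun j => (lam j).rowLen k - (lam j).rowLen i) using 1
  funext B
  simp [hookRatio]

theorem cumulant_hook_mem {ι : Type*} [DecidableEq ι] {lam : ι → YoungDiagram} {N : ℕ}
    (hN : ∀ i, (lam i).colLen 0 ≤ N) {H : Finset ι} (hH : H.Nonempty) :
    cumulant (fun B => hook (entrywiseSum lam B)) H ∈ alphaIdeal ^ (H.card - 1) :=
  cumulant_mem_pow_of_ratio alphaIdeal_le_one (by rw [entrywiseSum_empty, hook_bot])
    (hookRatio_mem_smallDifferences lam N)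
    (fun _ _ => hook_entrywiseSum_insert fun i _ => hN i) hH

end Hook

/-! ### Dominance of exponent vectors -/

section MaxSum

variable {σ : Type*} [Fintype σ]

theorem sum_eq_add_add_sum_compl_pair {M : Type*} [AddCommMonoid M] [DecidableEq σ] {i j : σ}
    (h : i ≠ j) (g : σ → M) : ∑ k, g k = g i + g j + ∑ k ∈ {i, j}ᶜ, g k := by
  rw [← Finset.sum_add_sum_compl {i, j}, Finset.sum_pair h]

/-- The sum of the maxima of all ordered pairs of entries. On exponent vectors of given size it is
an increasing function for the dominance order, and up to a factor `-1/2` it is the part of the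
diagonal entries of the Laplace–Beltrami operator which does not involve `α`. -/
def maxSum (d : σ → ℕ) : ℕ := ∑ i, ∑ j, max (d i) (d j)

theorem maxSum_comp_perm (d : σ → ℕ) (e : Equiv.Perm σ) : maxSum (d ∘ e) = maxSum d := by
  unfold maxSum
  rw [← Equiv.sum_comp e (fun i => ∑ j, max (d i) (d j))]
  exact Finset.sum_congr rfl fun i _ => Equiv.sum_comp e fun j => max (d (e i)) (d j)

theorem maxSum_eq_add_sum_compl_pair [DecidableEq σ] (d : σ → ℕ) {i j : σ} (h : i ≠ j) :
    maxSum d = d i + d j + 2 * max (d i) (d j) +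
      2 * ∑ k ∈ {i, j}ᶜ, (max (d i) (d k) + max (d j) (d k)) +
      ∑ k ∈ {i, j}ᶜ, ∑ l ∈ {i, j}ᶜ, max (d k) (d l) := by
  have row (k : σ) : ∑ l, max (d k) (d l) =
      max (d i) (d k) + max (d j) (d k) + ∑ l ∈ {i, j}ᶜ, max (d k) (d l) := by
    rw [sum_eq_add_add_sum_compl_pair h, max_comm (d k), max_comm (d k)]
  rw [maxSum, sum_eq_add_add_sum_compl_pair h, row i, row j,
    Finset.sum_congr rfl fun k _ => row k, max_comm (d j) (d i)]
  simp only [Finset.sum_add_distrib, max_self]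
  ring

theorem maxSum_add_sum_of_antitone [LinearOrder σ] [LocallyFiniteOrderBot σ] {d : σ → ℕ}
    (hd : Antitone d) : maxSum d + ∑ i, d i = 2 * ∑ j, ∑ i ∈ Finset.Iic j, d i := by
  have split (i j : σ) : max (d i) (d j) + (if i = j then d i else 0) =
      (if i ≤ j then d i else 0) + (if j ≤ i then d j else 0) := by
    rcases lt_trichotomy i j with h | h | h
    · simp [h.ne, h.le, h.not_ge, hd h.le]
    · simp [h]
    · simp [h.ne', h.le, h.not_ge, hd h.le]
  have sum_Iic (j : σ) : ∑ i ∈ Finset.Iic j, d i = ∑ i, if i ≤ j then d i else 0 := by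
    rw [← Finset.sum_filter]
    exact Finset.sum_congr (by ext; simp) fun _ _ => rfl
  calc maxSum d + ∑ i, d i
      = ∑ i, ∑ j, (max (d i) (d j) + if i = j then d i else 0) := by
        simp [maxSum, Finset.sum_add_distrib]
    _ = (∑ i, ∑ j, if i ≤ j then d i else 0) + ∑ i, ∑ j, if j ≤ i then d j else 0 := by
        simp only [split, Finset.sum_add_distrib]
    _ = 2 * ∑ j, ∑ i ∈ Finset.Iic j, d i := by
        simp only [sum_Iic]
        rw [Finset.sum_comm, two_mul]

theorem eq_of_forall_sum_Iic_eq {ι M : Type*} [PartialOrder ι] [LocallyFiniteOrderBot ι]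
    [WellFoundedLT ι] [AddCommMonoid M] [IsRightCancelAdd M] {a b : ι → M}
    (h : ∀ j, ∑ i ∈ Finset.Iic j, a i = ∑ i ∈ Finset.Iic j, b i) : a = b := by
  classical
  funext j
  induction j using WellFoundedLT.induction with
  | _ j ih =>
    have := h j
    rw [← Finset.Iio_insert, Finset.sum_insert (by simp), Finset.sum_insert (by simp),
      Finset.sum_congr rfl fun i hi => ih i (Finset.mem_Iio.mp hi)] at this
    exact add_right_cancel this

end MaxSum

section Spread

variable {σ : Type*} [DecidableEq σ]

/-- The exponent vector with `i`-th entry `a` and the same sum of the entries `i` and `j`. For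
`a < min (d i) (d j)` it is obtained from `d` by moving the entries `i` and `j` apart; the
subtraction does not truncate in that case. -/
def spread (d : σ → ℕ) (i j : σ) (a : ℕ) : σ → ℕ :=
  Function.update (Function.update d i a) j (d i + d j - a)

theorem spread_left (d : σ → ℕ) {i j : σ} (h : i ≠ j) (a : ℕ) : spread d i j a i = a := by
  simp [spread, h]

theorem spread_right (d : σ → ℕ) (i j : σ) (a : ℕ) : spread d i j a j = d i + d j - a := by
  simp [spread]

theorem spread_of_ne (d : σ → ℕ) {i j k : σ} (hi : k ≠ i) (hj : k ≠ j) (a : ℕ) :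
    spread d i j a k = d k := by
  simp [spread, hi, hj]

theorem sum_spread_of_notMem (d : σ → ℕ) {i j : σ} (a : ℕ) {S : Finset σ}
    (hi : i ∉ S) (hj : j ∉ S) : ∑ k ∈ S, spread d i j a k = ∑ k ∈ S, d k :=
  Finset.sum_congr rfl fun _ hk =>
    spread_of_ne d (ne_of_mem_of_not_mem hk hi) (ne_of_mem_of_not_mem hk hj) a

theorem sum_spread_of_mem (d : σ → ℕ) {i j : σ} (h : i ≠ j) {a : ℕ} (ha : a ≤ d i + d j)
    {S : Finset σ} (hi : i ∈ S) (hj : j ∈ S) : ∑ k ∈ S, spread d i j a k = ∑ k ∈ S, d k := by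
  have hj' : j ∈ S.erase i := Finset.mem_erase.mpr ⟨h.symm, hj⟩
  rw [← Finset.add_sum_erase S _ hi, ← Finset.add_sum_erase _ _ hj',
    ← Finset.add_sum_erase S _ hi, ← Finset.add_sum_erase _ _ hj', spread_left d h,
    spread_right, sum_spread_of_notMem d a (by simp) (by simp)]
  omega

theorem spread_self (d : σ → ℕ) (i j : σ) : spread d i j (d i) = d := by
  simp [spread]

theorem spread_spread (d : σ → ℕ) {i j : σ} (h : i ≠ j) {b : ℕ} (hb : b ≤ d i + d j) (a : ℕ) :
    spread (spread d i j b) i j a = spread d i j a := by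
  rw [spread, spread_left d h, spread_right, Nat.add_sub_cancel' hb, spread, spread,
    Function.update_comm h, Function.update_idem, Function.update_comm h.symm,
    Function.update_idem]

theorem spread_comp_swap (d : σ → ℕ) {i j : σ} (h : i ≠ j) {a b : ℕ} (hab : a + b = d i + d j) :
    spread d i j a ∘ Equiv.swap i j = spread d i j b := by
  funext k
  rcases eq_or_ne k i with rfl | hki
  · simp only [Function.comp, Equiv.swap_apply_left, spread_right, spread_left d h]
    omega
  rcases eq_or_ne k j with rfl | hkj
  · simp only [Function.comp, Equiv.swap_apply_right, spread_right, spread_left d h]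
    omega
  · simp only [Function.comp, Equiv.swap_apply_of_ne_of_ne hki hkj, spread_of_ne d hki hkj]

theorem spread_comp_perm (d : σ → ℕ) (e : Equiv.Perm σ) (i j : σ) (a : ℕ) :
    spread (d ∘ e) i j a = spread d (e i) (e j) a ∘ e := by
  funext k
  simp only [spread, Function.comp, Function.update_apply, e.injective.eq_iff]

theorem sum_le_sum_spread [Fintype σ] (d : σ → ℕ) {i j : σ} {a : ℕ} (ha : a < min (d i) (d j)) :
    ∑ k, d k ≤ ∑ k, spread d i j a k := by
  rcases eq_or_ne i j with rfl | h
  · refine Finset.sum_le_sum fun k _ => ?_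
    rcases eq_or_ne k i with rfl | hk
    · rw [spread_right]
      omega
    · rw [spread_of_ne d hk hk]
  · exact (sum_spread_of_mem d h (by omega) (Finset.mem_univ i) (Finset.mem_univ j)).ge

theorem maxSum_lt_maxSum_spread [Fintype σ] (d : σ → ℕ) {i j : σ} (h : i ≠ j) {a : ℕ}
    (ha : a < min (d i) (d j)) : maxSum d < maxSum (spread d i j a) := by
  have unchanged : ∀ k ∈ ({i, j}ᶜ : Finset σ), spread d i j a k = d k := fun k hk => by
    simp only [Finset.mem_compl, Finset.mem_insert, Finset.mem_singleton, not_or] at hk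
    exact spread_of_ne d hk.1 hk.2 a
  rw [maxSum_eq_add_sum_compl_pair d h, maxSum_eq_add_sum_compl_pair (spread d i j a) h,
    spread_left d h, spread_right]
  have h_outer : ∑ k ∈ {i, j}ᶜ, ∑ l ∈ {i, j}ᶜ, max (spread d i j a k) (spread d i j a l) =
      ∑ k ∈ {i, j}ᶜ, ∑ l ∈ {i, j}ᶜ, max (d k) (d l) :=
    Finset.sum_congr rfl fun k hk => Finset.sum_congr rfl fun l hl => by
      rw [unchanged k hk, unchanged l hl]
  have h_mixed : ∑ k ∈ {i, j}ᶜ, (max (d i) (d k) + max (d j) (d k)) ≤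
      ∑ k ∈ {i, j}ᶜ, (max a (spread d i j a k) + max (d i + d j - a) (spread d i j a k)) := by
    refine Finset.sum_le_sum fun k hk => ?_
    rw [unchanged k hk]
    omega
  rw [h_outer]
  omega

end Spread

section Dominance

variable {σ : Type*} [Fintype σ] {N : ℕ} {lam nu : YoungDiagram}

/-- The exponent vectors of the monomials of the `m_nu` with `nu ≤ lam` in dominance order. Testing
all sums of entries, not only the initial ones, makes the condition invariant under
permutations. -/
def DominatedBy (lam : YoungDiagram) (d : σ → ℕ) : Prop :=
  ∑ i, d i = lam.card ∧
    ∀ S : Finset σ, ∑ i ∈ S, d i ≤ ∑ k ∈ Finset.range S.card, lam.rowLen k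

theorem DominatedBy.comp_perm {d : σ → ℕ} (h : DominatedBy lam d) (e : Equiv.Perm σ) :
    DominatedBy lam (d ∘ e) := by
  refine ⟨(Equiv.sum_comp e d).trans h.1, fun S => ?_⟩
  have := h.2 (S.map e.toEmbedding)
  rwa [Finset.sum_map, Finset.card_map] at this

theorem DominatedBy.of_spread [DecidableEq σ] {d : σ → ℕ} {i j : σ} (h : i ≠ j) {a : ℕ}
    (ha : a < min (d i) (d j)) (hd : DominatedBy lam (spread d i j a)) : DominatedBy lam d := by
  have ha' : a ≤ d i + d j := by omega
  refine ⟨(sum_spread_of_mem d h ha' (by simp) (by simp)).symm.trans hd.1, fun S => ?_⟩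
  by_cases hi : i ∈ S <;> by_cases hj : j ∈ S
  · exact (sum_spread_of_mem d h ha' hi hj).ge.trans (hd.2 S)
  · have hj' : j ∉ S.erase i := fun hh => hj (Finset.mem_of_mem_erase hh)
    have := hd.2 (insert j (S.erase i))
    rw [Finset.sum_insert hj', Finset.card_insert_of_notMem hj', Finset.card_erase_add_one hi,
      spread_right, sum_spread_of_notMem d a (by simp) hj'] at this
    rw [← Finset.add_sum_erase S _ hi]
    omega
  · have := hd.2 S
    rw [← Finset.add_sum_erase S _ hj, spread_right,
      sum_spread_of_notMem d a (fun hh => hi (Finset.mem_of_mem_erase hh)) (by simp)] at this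
    rw [← Finset.add_sum_erase S _ hj]
    omega
  · exact (sum_spread_of_notMem d a hi hj).ge.trans (hd.2 S)

/-- The exponent vector of the leading monomial of `m_lam`, which involves only the first `N` parts
of `lam`. -/
def rowVec (N : ℕ) (lam : YoungDiagram) (i : Fin N) : ℕ := lam.rowLen i

theorem rowVec_antitone (lam : YoungDiagram) : Antitone (rowVec N lam) :=
  fun i j h => lam.rowLen_anti i j h

theorem sum_range_rowLen (hN : lam.colLen 0 ≤ N) :
    ∑ k ∈ Finset.range N, lam.rowLen k = lam.card := by
  have := Multiplicative.toAdd.congr_arg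
    (prod_cells hN (fun _ => Multiplicative.ofAdd 1))
  simp only [toAdd_prod, toAdd_ofAdd, Finset.sum_const, Finset.card_range, smul_eq_mul,
    mul_one] at this
  exact this.symm

theorem sum_rowVec (hN : lam.colLen 0 ≤ N) : ∑ i, rowVec N lam i = lam.card :=
  (Fin.sum_univ_eq_sum_range (fun k => lam.rowLen k) N).trans (sum_range_rowLen hN)

theorem sum_Iic_rowVec (lam : YoungDiagram) (j : Fin N) :
    ∑ i ∈ Finset.Iic j, rowVec N lam i = ∑ k ∈ Finset.range (j + 1), lam.rowLen k := by
  rw [Nat.range_succ_eq_Iic, ← Fin.map_valEmbedding_Iic, Finset.sum_map]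
  rfl

theorem sum_le_sum_range_of_antitone {M : Type*} [AddCommMonoid M] [PartialOrder M]
    [IsOrderedAddMonoid M] {a : ℕ → M} (ha : Antitone a) (T : Finset ℕ) :
    ∑ i ∈ T, a i ≤ ∑ k ∈ Finset.range T.card, a k := by
  induction T using Finset.induction_on_max with
  | empty => simp
  | insert m S hm ih =>
    have hmS : m ∉ S := fun h => lt_irrefl _ (hm m h)
    rw [Finset.sum_insert hmS, Finset.card_insert_of_notMem hmS, Finset.sum_range_succ, add_comm]
    refine add_le_add ih (ha ?_)
    simpa using Finset.card_le_card fun x hx => Finset.mem_range.mpr (hm x hx)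

theorem dominatedBy_rowVec (hN : nu.colLen 0 ≤ N) (hcard : nu.card = lam.card)
    (h : ∀ j : ℕ, ∑ i ∈ Finset.range j, nu.rowLen i ≤ ∑ i ∈ Finset.range j, lam.rowLen i) :
    DominatedBy lam (rowVec N nu) := by
  refine ⟨(sum_rowVec hN).trans hcard, fun S => ?_⟩
  have := sum_le_sum_range_of_antitone (a := nu.rowLen) (fun i j h => nu.rowLen_anti i j h)
    (S.map Fin.valEmbedding)
  rw [Finset.sum_map, Finset.card_map] at this
  exact this.trans (h S.card)

theorem DominatedBy.sum_Iic_le {d : Fin N → ℕ} (h : DominatedBy lam d) (j : Fin N) :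
    ∑ i ∈ Finset.Iic j, d i ≤ ∑ i ∈ Finset.Iic j, rowVec N lam i := by
  rw [sum_Iic_rowVec]
  simpa using h.2 (Finset.Iic j)

theorem DominatedBy.sum_range_rowLen_le (hnu : nu.colLen 0 ≤ N) (hlam : lam.colLen 0 ≤ N)
    (h : DominatedBy lam (rowVec N nu)) (j : ℕ) :
    ∑ i ∈ Finset.range j, nu.rowLen i ≤ ∑ i ∈ Finset.range j, lam.rowLen i := by
  rcases le_total j N with hj | hj
  · have := h.2 (Finset.univ.map (Fin.castLEEmb hj))
    rw [Finset.sum_map, Finset.card_map, Finset.card_univ, Fintype.card_fin] at this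
    exact (Fin.sum_univ_eq_sum_range (fun k => nu.rowLen k) j).ge.trans this
  · rw [sum_range_rowLen (hnu.trans hj), sum_range_rowLen (hlam.trans hj), ← h.1, sum_rowVec hnu]

theorem exists_perm_antitone {α : Type*} [LinearOrder α] (d : Fin N → α) :
    ∃ e : Equiv.Perm (Fin N), Antitone (d ∘ e) :=
  ⟨Tuple.sort (fun i => OrderDual.toDual (d i)), fun _ _ h =>
    Tuple.monotone_sort (fun i => OrderDual.toDual (d i)) h⟩

theorem DominatedBy.exists_perm_maxSum_add (hN : lam.colLen 0 ≤ N) {d : Fin N → ℕ}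
    (h : DominatedBy lam d) : ∃ e : Equiv.Perm (Fin N), DominatedBy lam (d ∘ e) ∧
      maxSum d + 2 * ∑ j, ∑ i ∈ Finset.Iic j, rowVec N lam i =
        maxSum (rowVec N lam) + 2 * ∑ j, ∑ i ∈ Finset.Iic j, (d ∘ e) i := by
  obtain ⟨e, he⟩ := exists_perm_antitone d
  refine ⟨e, h.comp_perm e, ?_⟩
  have hd := maxSum_add_sum_of_antitone he
  have hrow := maxSum_add_sum_of_antitone (rowVec_antitone (N := N) lam)
  rw [maxSum_comp_perm, (h.comp_perm e).1] at hd
  rw [sum_rowVec hN] at hrow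
  omega

theorem DominatedBy.maxSum_le (hN : lam.colLen 0 ≤ N) {d : Fin N → ℕ} (h : DominatedBy lam d) :
    maxSum d ≤ maxSum (rowVec N lam) := by
  obtain ⟨e, he, hsum⟩ := h.exists_perm_maxSum_add hN
  have := Finset.sum_le_sum fun j (_ : j ∈ Finset.univ) => he.sum_Iic_le j
  omega

theorem DominatedBy.exists_perm_of_maxSum_le (hN : lam.colLen 0 ≤ N) {d : Fin N → ℕ}
    (h : DominatedBy lam d) (hd : maxSum (rowVec N lam) ≤ maxSum d) :
    ∃ e : Equiv.Perm (Fin N), d ∘ e = rowVec N lam := by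
  obtain ⟨e, he, hsum⟩ := h.exists_perm_maxSum_add hN
  refine ⟨e, eq_of_forall_sum_Iic_eq fun j => ?_⟩
  have hle := fun j (_ : j ∈ Finset.univ) => he.sum_Iic_le j
  have heq : ∑ j, ∑ i ∈ Finset.Iic j, (d ∘ e) i = ∑ j, ∑ i ∈ Finset.Iic j, rowVec N lam i :=
    le_antisymm (Finset.sum_le_sum hle) (by omega)
  exact (Finset.sum_eq_sum_iff_of_le hle).mp heq j (Finset.mem_univ j)

end Dominance

/-! ### The Laplace–Beltrami operator on monomials -/

section Coefficients

variable {σ R : Type*} [Finite σ] [CommSemiring R]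

/-- The coefficient of the monomial with exponent vector `d`, as a linear form. Exponent vectors
are plain functions here, so that they can be permuted and updated freely. -/
def coeffAt (d : σ → ℕ) : MvPolynomial σ R →ₗ[R] R :=
  MvPolynomial.lcoeff R (Finsupp.equivFunOnFinite.symm d)

theorem coeffAt_apply (d : σ → ℕ) (P : MvPolynomial σ R) :
    coeffAt d P = MvPolynomial.coeff (Finsupp.equivFunOnFinite.symm d) P := rfl

theorem coeff_eq_coeffAt (m : σ →₀ ℕ) (P : MvPolynomial σ R) :
    MvPolynomial.coeff m P = coeffAt m P := by
  rw [coeffAt_apply, Finsupp.equivFunOnFinite_symm_coe]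

theorem ext_coeffAt {P Q : MvPolynomial σ R} (h : ∀ d : σ → ℕ, coeffAt d P = coeffAt d Q) :
    P = Q :=
  MvPolynomial.ext _ _ fun m => by rw [coeff_eq_coeffAt, coeff_eq_coeffAt, h]

open Classical in
theorem coeffAt_monomial (d : σ → ℕ) (m : σ →₀ ℕ) (c : R) :
    coeffAt d (MvPolynomial.monomial m c) = if (m : σ → ℕ) = d then c else 0 := by
  rw [coeffAt_apply, MvPolynomial.coeff_monomial]
  refine if_congr ⟨fun h => ?_, fun h => ?_⟩ rfl rfl
  · rw [h]; rfl
  · rw [← h, Finsupp.equivFunOnFinite_symm_coe]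

theorem coeffAt_C_mul (d : σ → ℕ) (c : R) (P : MvPolynomial σ R) :
    coeffAt d (MvPolynomial.C c * P) = c * coeffAt d P :=
  MvPolynomial.coeff_C_mul _ _ _

theorem finite_support_coeffAt (P : MvPolynomial σ R) :
    (Function.support fun d => coeffAt d P).Finite := by
  refine (P.support.finite_toSet.image DFunLike.coe).subset fun d hd => ?_
  exact ⟨Finsupp.equivFunOnFinite.symm d, MvPolynomial.mem_support_iff.mpr hd, rfl⟩

theorem exists_coeffAt_eq {f : (σ → ℕ) → R} (hf : (Function.support f).Finite) :
    ∃ P : MvPolynomial σ R, ∀ d, coeffAt d P = f d := by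
  classical
  refine ⟨∑ d ∈ hf.toFinset,
    MvPolynomial.monomial (Finsupp.equivFunOnFinite.symm d) (f d), fun d => ?_⟩
  rw [map_sum, Finset.sum_eq_single d]
  · exact (coeffAt_monomial d _ _).trans (if_pos rfl)
  · exact fun e _ hne => (coeffAt_monomial d _ _).trans (if_neg hne)
  · intro hd
    rw [Set.Finite.mem_toFinset, Function.notMem_support] at hd
    rw [hd, MvPolynomial.monomial_zero, map_zero]

theorem exists_coeffAt_ne_zero_of_mul {d : σ → ℕ} {P Q : MvPolynomial σ R}
    (h : coeffAt d (P * Q) ≠ 0) :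
    ∃ a b : σ → ℕ, a + b = d ∧ coeffAt a P ≠ 0 ∧ coeffAt b Q ≠ 0 := by
  classical
  rw [coeffAt_apply, MvPolynomial.coeff_mul] at h
  obtain ⟨⟨a, b⟩, hab, hne⟩ := Finset.exists_ne_zero_of_sum_ne_zero h
  rw [coeff_eq_coeffAt, coeff_eq_coeffAt] at hne
  refine ⟨a, b, ?_, left_ne_zero_of_mul hne, right_ne_zero_of_mul hne⟩
  rw [← Finsupp.coe_add, Finset.HasAntidiagonal.mem_antidiagonal.mp hab]
  rfl

theorem coeffAt_add_mul {a b : σ → ℕ} {P Q : MvPolynomial σ R}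
    (h : ∀ a' b', a' + b' = a + b → coeffAt a' P ≠ 0 → coeffAt b' Q ≠ 0 → a' = a) :
    coeffAt (a + b) (P * Q) = coeffAt a P * coeffAt b Q := by
  classical
  rw [coeffAt_apply, MvPolynomial.coeff_mul,
    Finset.sum_eq_single (Finsupp.equivFunOnFinite.symm a, Finsupp.equivFunOnFinite.symm b)]
  · rfl
  · rintro ⟨a', b'⟩ hab hne
    by_contra h0
    rw [coeff_eq_coeffAt, coeff_eq_coeffAt] at h0
    have hsum : (a' : σ → ℕ) + b' = a + b := by
      rw [← Finsupp.coe_add, Finset.HasAntidiagonal.mem_antidiagonal.mp hab]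
      rfl
    have ha := h a' b' hsum (left_ne_zero_of_mul h0) (right_ne_zero_of_mul h0)
    have hb : (b' : σ → ℕ) = b := add_left_cancel (ha ▸ hsum)
    exact hne (Prod.ext (DFunLike.coe_injective ha) (DFunLike.coe_injective hb))
  · exact fun hn => absurd (Finset.HasAntidiagonal.mem_antidiagonal.mpr (by ext; rfl)) hn

theorem coeffAt_rename (e : Equiv.Perm σ) (d : σ → ℕ) (P : MvPolynomial σ R) :
    coeffAt d (MvPolynomial.rename e P) = coeffAt (d ∘ e) P := by
  rw [coeffAt_apply, coeffAt_apply, ← MvPolynomial.coeff_rename_mapDomain e e.injective P]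
  congr 1
  ext i
  obtain ⟨j, rfl⟩ := e.surjective i
  rw [Finsupp.mapDomain_apply e.injective]
  rfl

theorem isSymmetric_iff_coeffAt {P : MvPolynomial σ R} :
    P.IsSymmetric ↔ ∀ (e : Equiv.Perm σ) (d : σ → ℕ), coeffAt (d ∘ e) P = coeffAt d P :=
  ⟨fun h e d => by rw [← coeffAt_rename, h e],
    fun h e => ext_coeffAt fun d => (coeffAt_rename e d P).trans (h e d)⟩

theorem coeffAt_X_mul_pderiv (d : σ → ℕ) (i : σ) (P : MvPolynomial σ R) :
    coeffAt d (MvPolynomial.X i * MvPolynomial.pderiv i P) = (d i : R) * coeffAt d P := by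
  induction P using MvPolynomial.induction_on' with
  | monomial m c =>
    rw [MvPolynomial.X_mul_pderiv_monomial, map_nsmul, coeffAt_monomial]
    split_ifs with h
    · rw [h, nsmul_eq_mul]
    · simp
  | add p q hp hq =>
    rw [map_add, mul_add, map_add, hp, hq, map_add, mul_add]

variable [DecidableEq σ]

theorem coeffAt_X_mul (d : σ → ℕ) (i : σ) (P : MvPolynomial σ R) :
    coeffAt d (MvPolynomial.X i * P) =
      if d i = 0 then 0 else coeffAt (Function.update d i (d i - 1)) P := by
  rw [coeffAt_apply, MvPolynomial.coeff_X_mul', coeffAt_apply]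
  by_cases h : d i = 0
  · rw [if_pos h, if_neg (by simpa using h)]
  · rw [if_neg h, if_pos (by simpa using h)]
    congr 1
    ext j
    rcases eq_or_ne j i with rfl | hj
    · simp
    · simp [hj]

theorem coeffAt_X_sq_mul_pderiv (d : σ → ℕ) (i : σ) (P : MvPolynomial σ R) :
    coeffAt d (MvPolynomial.X i ^ 2 * MvPolynomial.pderiv i P) =
      ((d i - 1 : ℕ) : R) * coeffAt (Function.update d i (d i - 1)) P := by
  rw [pow_two, mul_assoc, coeffAt_X_mul, coeffAt_X_mul_pderiv]
  split_ifs with h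
  · simp [h]
  · simp

end Coefficients

section PairQuotient

variable {σ R : Type*} [DecidableEq σ]

section CommSemiring

variable [CommSemiring R]

/-- The coefficients of the quotient of `x_i² ∂_i f - x_j² ∂_j f` by `x_i - x_j`, in terms of the
coefficients of a symmetric polynomial `f`. -/
def pairCoeff (f : (σ → ℕ) → R) (i j : σ) (d : σ → ℕ) : R :=
  (max (d i) (d j) : ℕ) * f d + ∑ a ∈ Finset.range (min (d i) (d j)),
    ((d i + d j - 2 * a : ℕ) : R) * f (spread d i j a)

theorem pairCoeff_comp_perm {f : (σ → ℕ) → R}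
    (hf : ∀ (e : Equiv.Perm σ) (d : σ → ℕ), f (d ∘ e) = f d) (i j : σ) (e : Equiv.Perm σ)
    (d : σ → ℕ) : pairCoeff f i j (d ∘ e) = pairCoeff f (e i) (e j) d := by
  simp only [pairCoeff, spread_comp_perm, hf]
  rfl

theorem pairCoeff_spread (f : (σ → ℕ) → R) {i j : σ} (h : i ≠ j) (d : σ → ℕ)
    {b : ℕ} (hb : b ≤ d i + d j) : pairCoeff f i j (spread d i j b) =
      (max b (d i + d j - b) : ℕ) * f (spread d i j b) +
        ∑ a ∈ Finset.range (min b (d i + d j - b)),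
          ((d i + d j - 2 * a : ℕ) : R) * f (spread d i j a) := by
  simp only [pairCoeff, spread_left d h, spread_right, spread_spread d h hb,
    Nat.add_sub_cancel' hb]

variable [Finite σ]

theorem finite_support_pairCoeff {f : (σ → ℕ) → R} (hf : (Function.support f).Finite) (i j : σ) :
    (Function.support (pairCoeff f i j)).Finite := by
  cases nonempty_fintype σ
  obtain ⟨n, hn⟩ := (hf.image fun d => ∑ k, d k).bddAbove
  refine (Set.finite_Iic fun _ => n).subset fun d hd k => ?_
  obtain ⟨e, he, hle⟩ : ∃ e, f e ≠ 0 ∧ ∑ k, d k ≤ ∑ k, e k := by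
    by_contra! hcon
    refine hd ?_
    rw [pairCoeff, not_not.mp fun h => (hcon d h).false, mul_zero, zero_add]
    refine Finset.sum_eq_zero fun a ha => ?_
    rw [not_not.mp fun h => (hcon _ h).not_ge (sum_le_sum_spread d (Finset.mem_range.mp ha)),
      mul_zero]
  calc d k ≤ ∑ k, d k := Finset.single_le_sum (fun _ _ => Nat.zero_le _) (Finset.mem_univ k)
    _ ≤ n := hle.trans (hn ⟨e, he, rfl⟩)

theorem exists_coeffAt_eq_pairCoeff (i j : σ) (P : MvPolynomial σ R) :
    ∃ Q : MvPolynomial σ R, ∀ d, coeffAt d Q = pairCoeff (fun d => coeffAt d P) i j d :=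
  exists_coeffAt_eq (finite_support_pairCoeff (finite_support_coeffAt P) i j)

/-- The linear operator on polynomials which is `f ↦ (x_i² ∂_i f - x_j² ∂_j f) / (x_i - x_j)` on
symmetric polynomials; see `sub_mul_pairQuotient`. -/
def pairQuotient (i j : σ) : MvPolynomial σ R →ₗ[R] MvPolynomial σ R where
  toFun P := (exists_coeffAt_eq_pairCoeff i j P).choose
  map_add' P Q := ext_coeffAt fun d => by
    rw [map_add, (exists_coeffAt_eq_pairCoeff i j _).choose_spec,
      (exists_coeffAt_eq_pairCoeff i j _).choose_spec,
      (exists_coeffAt_eq_pairCoeff i j _).choose_spec]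
    simp only [map_add, pairCoeff, mul_add, Finset.sum_add_distrib]
    exact add_add_add_comm _ _ _ _
  map_smul' c P := ext_coeffAt fun d => by
    rw [map_smul, (exists_coeffAt_eq_pairCoeff i j _).choose_spec,
      (exists_coeffAt_eq_pairCoeff i j _).choose_spec]
    simp only [map_smul, pairCoeff, smul_eq_mul, RingHom.id_apply, mul_add, Finset.mul_sum,
      mul_left_comm c]

theorem coeffAt_pairQuotient (i j : σ) (P : MvPolynomial σ R) (d : σ → ℕ) :
    coeffAt d (pairQuotient i j P) = pairCoeff (fun d => coeffAt d P) i j d :=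
  (exists_coeffAt_eq_pairCoeff i j P).choose_spec d

end CommSemiring

variable [CommRing R]

theorem telescope_of_symmetric {F : ℕ → R} (p q : ℕ)
    (hF : ∀ a b, a + b = p + q + 1 → F a = F b) :
    ((max p (q + 1) : ℕ) * F p + ∑ a ∈ Finset.range (min p (q + 1)),
        ((p + q + 1 - 2 * a : ℕ) : R) * F a) -
      ((max (p + 1) q : ℕ) * F (p + 1) + ∑ a ∈ Finset.range (min (p + 1) q),
        ((p + q + 1 - 2 * a : ℕ) : R) * F a) = p * F p - q * F (p + 1) := by
  rcases lt_trichotomy p q with h | rfl | h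
  · rw [max_eq_right (by omega), max_eq_right (by omega), min_eq_left (by omega),
      min_eq_left (by omega), Finset.sum_range_succ, Nat.cast_sub (by omega)]
    push_cast
    ring
  · rw [max_eq_right (by omega), max_eq_left (by omega), min_eq_left (by omega),
      min_eq_right (by omega), hF p (p + 1) (by omega)]
    ring
  · rw [max_eq_left (by omega), max_eq_left (by omega), min_eq_right (by omega),
      min_eq_right (by omega), Finset.sum_range_succ, Nat.cast_sub (by omega),
      hF q (p + 1) (by omega)]
    push_cast
    ring

theorem pairCoeff_sub_pairCoeff {f : (σ → ℕ) → R}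
    (hf : ∀ (e : Equiv.Perm σ) (d : σ → ℕ), f (d ∘ e) = f d) {i j : σ} (h : i ≠ j) {d : σ → ℕ}
    {p q : ℕ} (hi : d i = p + 1) (hj : d j = q + 1) :
    pairCoeff f i j (Function.update d i p) - pairCoeff f i j (Function.update d j q) =
      p * f (Function.update d i p) - q * f (Function.update d j q) := by
  set c := Function.update d i p with hc
  have hci : c i = p := Function.update_self ..
  have hcj : c j = q + 1 := (Function.update_of_ne h.symm ..).trans hj
  have hp : c = spread c i j p := by rw [← hci, spread_self]
  have hq : Function.update d j q = spread c i j (p + 1) := by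
    rw [spread, hc, Function.update_idem, ← hi, Function.update_eq_self]
    congr 1
    rw [← hc, hci, hcj]
    omega
  have hF (a b : ℕ) (hab : a + b = p + q + 1) : f (spread c i j a) = f (spread c i j b) := by
    rw [← spread_comp_swap c h (a := b) (b := a) (by omega), hf]
  have ht := telescope_of_symmetric p q hF
  rw [← hp] at ht
  rw [hq, pairCoeff_spread f h c (by omega), pairCoeff, hci, hcj,
    show p + (q + 1) - (p + 1) = q by omega]
  exact ht

theorem sub_mul_pairQuotient [Finite σ] {P : MvPolynomial σ R} (hP : P.IsSymmetric) {i j : σ}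
    (h : i ≠ j) :
    (MvPolynomial.X i - MvPolynomial.X j) * pairQuotient i j P =
      MvPolynomial.X i ^ 2 * MvPolynomial.pderiv i P -
        MvPolynomial.X j ^ 2 * MvPolynomial.pderiv j P := by
  refine ext_coeffAt fun d => ?_
  rw [sub_mul, map_sub, map_sub, coeffAt_X_mul, coeffAt_X_mul, coeffAt_X_sq_mul_pderiv,
    coeffAt_X_sq_mul_pderiv, coeffAt_pairQuotient, coeffAt_pairQuotient]
  rcases hi : d i with _ | p <;> rcases hj : d j with _ | q
  · simp
  · simp [pairCoeff, Function.update_of_ne h, hi]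
  · simp [pairCoeff, Function.update_of_ne h.symm, hj]
  · simpa using pairCoeff_sub_pairCoeff (isSymmetric_iff_coeffAt.mp hP) h hi hj

end PairQuotient

section LaplaceBeltrami

variable {N : ℕ}

theorem sum_ne_comm {ι M : Type*} [Fintype ι] [DecidableEq ι] [AddCommMonoid M] (f : ι → ι → M) :
    ∑ i, ∑ j with j ≠ i, f i j = ∑ i, ∑ j with j ≠ i, f j i := by
  simp only [Finset.sum_filter]
  rw [Finset.sum_comm]
  simp only [ne_comm]

theorem toRat_X_sub_X_ne_zero {i j : Fin N} (h : i ≠ j) :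
    toRat N (MvPolynomial.X i - MvPolynomial.X j) ≠ 0 := by
  rw [Ne, map_eq_zero_iff _ (IsFractionRing.injective (MvPolynomial (Fin N) QAlpha) _), sub_eq_zero]
  exact fun heq => h (MvPolynomial.X_injective heq)

theorem toRat_pairQuotient {P : MvPolynomial (Fin N) QAlpha} (hP : P.IsSymmetric) {i j : Fin N}
    (h : i ≠ j) : toRat N (pairQuotient i j P) =
      toRat N (MvPolynomial.X i ^ 2) / toRat N (MvPolynomial.X i - MvPolynomial.X j) *
          toRat N (MvPolynomial.pderiv i P) +
        toRat N (MvPolynomial.X j ^ 2) / toRat N (MvPolynomial.X j - MvPolynomial.X i) *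
          toRat N (MvPolynomial.pderiv j P) := by
  have hmul := congrArg (toRat N) (sub_mul_pairQuotient hP h)
  rw [map_mul, RingHom.map_sub _ (MvPolynomial.X i ^ 2 * _), map_mul, map_mul] at hmul
  rw [← neg_sub (MvPolynomial.X i) (MvPolynomial.X j), map_neg, div_neg, neg_mul, ← sub_eq_add_neg,
    div_mul_eq_mul_div, div_mul_eq_mul_div, ← sub_div, ← hmul,
    mul_div_cancel_left₀ _ (toRat_X_sub_X_ne_zero h)]

theorem coeffAt_D2 (d : Fin N → ℕ) (P : MvPolynomial (Fin N) QAlpha) :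
    coeffAt d (D2 N P) = ((∑ i, (d i).choose 2 : ℕ) : QAlpha) * coeffAt d P := by
  rw [D2, coeffAt_C_mul, map_sum, Nat.cast_sum, Finset.sum_mul, Finset.mul_sum]
  refine Finset.sum_congr rfl fun i _ => ?_
  have euler : MvPolynomial.X i ^ 2 * MvPolynomial.pderiv i (MvPolynomial.pderiv i P) =
      MvPolynomial.X i * MvPolynomial.pderiv i (MvPolynomial.X i * MvPolynomial.pderiv i P) -
        MvPolynomial.X i * MvPolynomial.pderiv i P := by
    rw [MvPolynomial.pderiv_mul, MvPolynomial.pderiv_X_self]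
    ring
  rw [euler, map_sub, coeffAt_X_mul_pderiv, coeffAt_X_mul_pderiv, Nat.cast_choose_two]
  ring

/-- The linear operator on polynomials which is the Laplace–Beltrami operator on symmetric
polynomials; see `laplaceBeltrami_eq_toRat`. -/
def polyLaplaceBeltrami (N : ℕ) :
    MvPolynomial (Fin N) QAlpha →ₗ[QAlpha] MvPolynomial (Fin N) QAlpha where
  toFun P := (1 / 2 : QAlpha) • (∑ i, ∑ j with j ≠ i, pairQuotient i j P) +
    MvPolynomial.C alpha * D2 N P
  map_add' P Q := ext_coeffAt fun d => by
    simp only [map_add, map_smul, map_sum, coeffAt_C_mul, coeffAt_D2, mul_add,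
      Finset.sum_add_distrib, smul_add]
    exact add_add_add_comm _ _ _ _
  map_smul' c P := ext_coeffAt fun d => by
    simp only [map_add, map_smul, map_sum, coeffAt_C_mul, coeffAt_D2, ← Finset.smul_sum,
      RingHom.id_apply, smul_eq_mul]
    ring

theorem coeffAt_polyLaplaceBeltrami (P : MvPolynomial (Fin N) QAlpha) (d : Fin N → ℕ) :
    coeffAt d (polyLaplaceBeltrami N P) =
      1 / 2 * (∑ i, ∑ j with j ≠ i, pairCoeff (fun d => coeffAt d P) i j d) +
        alpha * (((∑ i, (d i).choose 2 : ℕ) : QAlpha) * coeffAt d P) := by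
  simp only [polyLaplaceBeltrami, LinearMap.coe_mk, AddHom.coe_mk, map_add, map_smul, map_sum,
    coeffAt_C_mul, coeffAt_D2, coeffAt_pairQuotient, smul_eq_mul]

theorem laplaceBeltrami_eq_toRat {P : MvPolynomial (Fin N) QAlpha} (hP : P.IsSymmetric) :
    laplaceBeltrami N P = toRat N (polyLaplaceBeltrami N P) := by
  have hD1 : 2 * D1 N P = ∑ i, ∑ j with j ≠ i, toRat N (pairQuotient i j P) := by
    rw [two_mul, D1]
    nth_rewrite 2 [sum_ne_comm]
    simp only [← Finset.sum_add_distrib]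
    refine Finset.sum_congr rfl fun i _ => Finset.sum_congr rfl fun j hj => ?_
    exact (toRat_pairQuotient hP (Finset.mem_filter.mp hj).2.symm).symm
  have hhalf : 2 * toRat N (MvPolynomial.C (1 / 2)) = 1 := by
    rw [← map_ofNat (toRat N) 2, ← map_mul, ← map_ofNat MvPolynomial.C 2, ← map_mul]
    norm_num
  rw [laplaceBeltrami, polyLaplaceBeltrami, LinearMap.coe_mk, AddHom.coe_mk, map_add,
    MvPolynomial.smul_eq_C_mul, map_mul, map_mul]
  have hsum : toRat N (∑ i, ∑ j with j ≠ i, pairQuotient i j P) = 2 * D1 N P := by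
    simp only [hD1, map_sum]
  rw [hsum]
  linear_combination (-D1 N P) * hhalf

end LaplaceBeltrami

section Triangular

variable {σ : Type*} [Fintype σ]

/-- The diagonal entry of the Laplace–Beltrami operator at the exponent vector `d`. -/
def diagEntry (d : σ → ℕ) : QAlpha :=
  ((maxSum d : QAlpha) - (∑ i, d i : ℕ)) / 2 + alpha * (∑ i, (d i).choose 2 : ℕ)

theorem mem_of_diagEntry_sub_mul_mem (M : Submodule regularAtZero QAlpha) {d e : σ → ℕ}
    (hsum : ∑ i, d i = ∑ i, e i) (hmax : maxSum d ≠ maxSum e) {c : QAlpha}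
    (h : (diagEntry d - diagEntry e) * c ∈ M) : c ∈ M := by
  have twice_sub : 2 * (diagEntry d - diagEntry e) = ((maxSum d - maxSum e : ℤ) : QAlpha) +
      alpha * (2 * (∑ i, (d i).choose 2 : ℕ) - 2 * (∑ i, (e i).choose 2 : ℕ) : ℤ) := by
    simp only [diagEntry, hsum]
    push_cast
    ring
  have hne : (maxSum d - maxSum e : ℤ) ≠ 0 := sub_ne_zero.mpr (Nat.cast_injective.ne hmax)
  have hM := M.smul_mem ⟨_, inv_intCast_add_alpha_mul_mem_regularAtZero hne
    (2 * (∑ i, (d i).choose 2 : ℕ) - 2 * (∑ i, (e i).choose 2 : ℕ))⟩ (M.nsmul_mem h 2)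
  rwa [Subring.smul_def, smul_eq_mul, nsmul_eq_mul, Nat.cast_ofNat, ← mul_assoc 2, twice_sub,
    inv_mul_cancel_left₀ (intCast_add_alpha_mul_ne_zero hne _)] at hM

variable [DecidableEq σ]

theorem sum_ne_max (d : σ → ℕ) :
    ∑ i, ∑ j with j ≠ i, max (d i) (d j) + ∑ i, d i = maxSum d := by
  rw [maxSum, ← Finset.sum_add_distrib]
  refine Finset.sum_congr rfl fun i _ => ?_
  rw [Finset.filter_ne', add_comm, ← Finset.add_sum_erase _ _ (Finset.mem_univ i), max_self]

/-- The off-diagonal part of the Laplace–Beltrami operator, acting on coefficients. -/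
def spreadSum (f : (σ → ℕ) → QAlpha) (d : σ → ℕ) : QAlpha :=
  1 / 2 * ∑ i, ∑ j with j ≠ i, ∑ a ∈ Finset.range (min (d i) (d j)),
    ((d i + d j - 2 * a : ℕ) : QAlpha) * f (spread d i j a)

theorem exists_of_spreadSum_ne_zero {f : (σ → ℕ) → QAlpha} {d : σ → ℕ} (h : spreadSum f d ≠ 0) :
    ∃ i j a, i ≠ j ∧ a < min (d i) (d j) ∧ f (spread d i j a) ≠ 0 := by
  by_contra! hcon
  refine h (mul_eq_zero_of_right _ (Finset.sum_eq_zero fun i _ => Finset.sum_eq_zero fun j hj =>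
    Finset.sum_eq_zero fun a ha => ?_))
  rw [hcon i j a (Finset.mem_filter.mp hj).2.symm (Finset.mem_range.mp ha), mul_zero]

theorem spreadSum_mem (M : Submodule regularAtZero QAlpha) {f : (σ → ℕ) → QAlpha} {d : σ → ℕ}
    (h : ∀ i j a, i ≠ j → a < min (d i) (d j) → f (spread d i j a) ∈ M) : spreadSum f d ∈ M := by
  have half_mem : (1 / 2 : QAlpha) ∈ regularAtZero := by
    simpa using inv_intCast_add_alpha_mul_mem_regularAtZero two_ne_zero 0
  refine M.smul_mem ⟨_, half_mem⟩ (M.sum_mem fun i _ => M.sum_mem fun j hj => M.sum_mem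
    fun a ha => ?_)
  rw [← nsmul_eq_mul]
  exact M.nsmul_mem (h i j a (Finset.mem_filter.mp hj).2.symm (Finset.mem_range.mp ha)) _

end Triangular

section Eigenvalue

variable {N : ℕ} {lam : YoungDiagram}

theorem coeffAt_polyLaplaceBeltrami_eq (P : MvPolynomial (Fin N) QAlpha) (d : Fin N → ℕ) :
    coeffAt d (polyLaplaceBeltrami N P) =
      diagEntry d * coeffAt d P + spreadSum (fun d => coeffAt d P) d := by
  have hmax := congrArg (Nat.cast (R := QAlpha)) (sum_ne_max d)
  push_cast at hmax
  rw [coeffAt_polyLaplaceBeltrami]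
  simp only [pairCoeff, Finset.sum_add_distrib, ← Finset.sum_mul, spreadSum, diagEntry]
  rw [← hmax]
  push_cast
  ring

theorem sum_cells {M : Type*} [AddCommMonoid M] (hN : lam.colLen 0 ≤ N) (f : ℕ × ℕ → M) :
    ∑ c ∈ lam.cells, f c = ∑ k ∈ Finset.range N, ∑ c ∈ Finset.range (lam.rowLen k), f (k, c) :=
  prod_cells (M := Multiplicative M) hN f

theorem bStat_transpose (hN : lam.colLen 0 ≤ N) :
    bStat lam.transpose = ∑ i : Fin N, i * rowVec N lam i :=
  calc bStat lam.transpose = ∑ c ∈ lam.transpose.cells, c.2 := by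
        rw [sum_cells le_rfl]
        simp only [bStat, Finset.sum_range_id, Nat.choose_two_right]
    _ = ∑ c ∈ lam.cells, c.1 :=
        Finset.sum_nbij' (g := fun c : ℕ × ℕ => c.1) Prod.swap Prod.swap (by simp) (by simp)
          (by simp) (by simp) (by simp)
    _ = ∑ k ∈ Finset.range N, k * lam.rowLen k := by
        simp only [sum_cells hN, Finset.sum_const, Finset.card_range, smul_eq_mul, mul_comm]
    _ = ∑ i : Fin N, i * rowVec N lam i :=
        (Fin.sum_univ_eq_sum_range (fun k => k * lam.rowLen k) N).symm

theorem bStat_eq_sum_rowVec (hN : lam.colLen 0 ≤ N) :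
    bStat lam = ∑ i, (rowVec N lam i).choose 2 := by
  refine Eq.trans ?_ (Fin.sum_univ_eq_sum_range (fun k => (lam.rowLen k).choose 2) N).symm
  refine Finset.sum_subset (Finset.range_mono hN) fun k _ hk => ?_
  rw [Finset.mem_range, not_lt, ← rowLen_eq_zero_iff] at hk
  rw [hk, Nat.choose_zero_succ]

theorem maxSum_rowVec (hN : lam.colLen 0 ≤ N) :
    maxSum (rowVec N lam) + lam.card + 2 * bStat lam.transpose = 2 * (N * lam.card) := by
  have rows (i : Fin N) : ∑ _j ∈ Finset.Ici i, rowVec N lam i = (N - i) * rowVec N lam i := by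
    rw [Finset.sum_const, Fin.card_Ici, smul_eq_mul]
  have swap : ∑ j, ∑ i ∈ Finset.Iic j, rowVec N lam i = ∑ i : Fin N, (N - i) * rowVec N lam i := by
    rw [Finset.sum_comm' (t' := Finset.univ) (s' := fun i => Finset.Ici i) (by simp)]
    exact Finset.sum_congr rfl fun i _ => rows i
  have h := maxSum_add_sum_of_antitone (rowVec_antitone (N := N) lam)
  rw [sum_rowVec hN, swap] at h
  rw [h, bStat_transpose hN, ← mul_add, ← Finset.sum_add_distrib, ← sum_rowVec hN,
    Finset.mul_sum _ _ N]
  refine congrArg (2 * ·) (Finset.sum_congr rfl fun i _ => ?_)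
  rw [← add_mul, Nat.sub_add_cancel i.2.le]

theorem eigenvalue_eq_diagEntry (hN : lam.colLen 0 ≤ N) :
    eigenvalue N lam = diagEntry (rowVec N lam) := by
  have h := congrArg (Nat.cast (R := QAlpha)) (maxSum_rowVec hN)
  push_cast at h
  rw [eigenvalue, diagEntry, sum_rowVec hN, bStat_eq_sum_rowVec hN]
  linear_combination (-1 / 2 : QAlpha) * h

end Eigenvalue

section DominatedSpace

variable {N : ℕ} {lam : YoungDiagram} {P : MvPolynomial (Fin N) QAlpha}

/-- The symmetric polynomials all of whose monomials are dominated by `lam`, that is, the span of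
the monomial symmetric polynomials `m_nu` with `nu ≤ lam`. -/
def dominatedSpace (N : ℕ) (lam : YoungDiagram) : Submodule QAlpha (MvPolynomial (Fin N) QAlpha) :=
  Subalgebra.toSubmodule (MvPolynomial.symmetricSubalgebra (Fin N) QAlpha) ⊓
    MvPolynomial.restrictSupport QAlpha {m | DominatedBy lam m}

theorem mem_dominatedSpace : P ∈ dominatedSpace N lam ↔
    P.IsSymmetric ∧ ∀ d : Fin N → ℕ, coeffAt d P ≠ 0 → DominatedBy lam d := by
  refine and_congr Iff.rfl
    ⟨fun h d hd => h (MvPolynomial.mem_support_iff.mpr hd), fun h m hm => ?_⟩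
  exact h m (by rwa [← coeff_eq_coeffAt, ← MvPolynomial.mem_support_iff])

/-- The symmetric polynomials all of whose monomials are strictly dominated by `lam`. -/
def lowerSpace (N : ℕ) (lam : YoungDiagram) : Submodule QAlpha (MvPolynomial (Fin N) QAlpha) :=
  dominatedSpace N lam ⊓ LinearMap.ker (coeffAt (rowVec N lam))

theorem mem_lowerSpace :
    P ∈ lowerSpace N lam ↔ P ∈ dominatedSpace N lam ∧ coeffAt (rowVec N lam) P = 0 := Iff.rfl

theorem finite_setOf_dominatedBy (N : ℕ) (lam : YoungDiagram) :
    {m : Fin N →₀ ℕ | DominatedBy lam m}.Finite := by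
  refine Set.Finite.subset (Set.Finite.preimage DFunLike.coe_injective.injOn
    (Set.finite_Iic fun _ : Fin N => lam.card)) fun m hm k => ?_
  exact (Finset.single_le_sum (fun _ _ => Nat.zero_le _) (Finset.mem_univ k)).trans hm.1.le

instance finiteDimensional_lowerSpace : FiniteDimensional QAlpha (lowerSpace N lam) := by
  have := (finite_setOf_dominatedBy N lam).to_subtype
  have : FiniteDimensional QAlpha
      (MvPolynomial.restrictSupport QAlpha {m : Fin N →₀ ℕ | DominatedBy lam m}) :=
    (MvPolynomial.basisRestrictSupport QAlpha _).finiteDimensional_of_finite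
  exact Submodule.finiteDimensional_of_le (inf_le_left.trans inf_le_right)

/-- The operator `D_α - E`, with `E` the eigenvalue attached to `lam`. -/
def shiftedLaplaceBeltrami (N : ℕ) (lam : YoungDiagram) :
    MvPolynomial (Fin N) QAlpha →ₗ[QAlpha] MvPolynomial (Fin N) QAlpha :=
  polyLaplaceBeltrami N - eigenvalue N lam • LinearMap.id

theorem shiftedLaplaceBeltrami_apply (P : MvPolynomial (Fin N) QAlpha) :
    shiftedLaplaceBeltrami N lam P =
      polyLaplaceBeltrami N P - MvPolynomial.C (eigenvalue N lam) * P := by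
  rw [← MvPolynomial.smul_eq_C_mul]
  rfl

theorem coeffAt_shiftedLaplaceBeltrami (hN : lam.colLen 0 ≤ N) (P : MvPolynomial (Fin N) QAlpha)
    (d : Fin N → ℕ) : coeffAt d (shiftedLaplaceBeltrami N lam P) =
      (diagEntry d - diagEntry (rowVec N lam)) * coeffAt d P +
        spreadSum (fun d => coeffAt d P) d := by
  rw [shiftedLaplaceBeltrami_apply, map_sub, coeffAt_C_mul, coeffAt_polyLaplaceBeltrami_eq,
    eigenvalue_eq_diagEntry hN]
  ring

theorem coeffAt_mem_of_triangular (M : Submodule regularAtZero QAlpha) (hN : lam.colLen 0 ≤ N)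
    (hP : P ∈ dominatedSpace N lam) (htop : coeffAt (rowVec N lam) P ∈ M)
    (hshift : ∀ d, coeffAt d (shiftedLaplaceBeltrami N lam P) ∈ M) (d : Fin N → ℕ) :
    coeffAt d P ∈ M := by
  rw [mem_dominatedSpace] at hP
  induction hm : maxSum (rowVec N lam) - maxSum d using Nat.strong_induction_on generalizing d with
  | _ m ih =>
    by_cases h0 : coeffAt d P = 0
    · exact h0 ▸ M.zero_mem
    have hdom := hP.2 d h0
    by_cases hmax : maxSum (rowVec N lam) ≤ maxSum d
    · obtain ⟨e, he⟩ := hdom.exists_perm_of_maxSum_le hN hmax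
      rwa [← isSymmetric_iff_coeffAt.mp hP.1 e d, he]
    · have hspread : spreadSum (fun d => coeffAt d P) d ∈ M :=
        spreadSum_mem M fun i j a hij ha => by
          have := maxSum_lt_maxSum_spread d hij ha
          exact ih _ (by omega) _ rfl
      have hdiag := M.sub_mem (hshift d) hspread
      rw [coeffAt_shiftedLaplaceBeltrami hN, add_sub_cancel_right] at hdiag
      exact mem_of_diagEntry_sub_mul_mem M (hdom.1.trans (sum_rowVec hN).symm)
        (not_le.mp hmax).ne hdiag

theorem eq_zero_of_triangular (hN : lam.colLen 0 ≤ N) (hP : P ∈ lowerSpace N lam)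
    (hshift : shiftedLaplaceBeltrami N lam P = 0) : P = 0 := by
  refine ext_coeffAt fun d => ?_
  rw [map_zero]
  refine coeffAt_mem_of_triangular ⊥ hN hP.1 hP.2 (fun d => ?_) d
  rw [hshift, map_zero]
  rfl

theorem isSymmetric_polyLaplaceBeltrami (hP : P.IsSymmetric) :
    (polyLaplaceBeltrami N P).IsSymmetric := by
  refine isSymmetric_iff_coeffAt.mpr fun e d => ?_
  rw [isSymmetric_iff_coeffAt] at hP
  have hpair : ∑ i, ∑ j with j ≠ i, pairCoeff (fun d => coeffAt d P) i j (d ∘ e) =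
      ∑ i, ∑ j with j ≠ i, pairCoeff (fun d => coeffAt d P) i j d := by
    simp only [pairCoeff_comp_perm (f := fun d => coeffAt d P) hP, Finset.sum_filter]
    refine Eq.trans (Finset.sum_congr rfl fun i _ => ?_) (Equiv.sum_comp e _)
    refine Eq.trans ?_ (Equiv.sum_comp e _)
    simp only [ne_eq, e.injective.eq_iff]
  rw [coeffAt_polyLaplaceBeltrami, coeffAt_polyLaplaceBeltrami, hP, hpair]
  congr 4
  exact Equiv.sum_comp e fun i => (d i).choose 2

theorem shiftedLaplaceBeltrami_mem_lowerSpace (hN : lam.colLen 0 ≤ N)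
    (hP : P ∈ dominatedSpace N lam) : shiftedLaplaceBeltrami N lam P ∈ lowerSpace N lam := by
  rw [mem_dominatedSpace] at hP
  refine mem_lowerSpace.mpr ⟨mem_dominatedSpace.mpr ⟨?_, fun d hd => ?_⟩, ?_⟩
  · rw [shiftedLaplaceBeltrami_apply]
    exact (isSymmetric_polyLaplaceBeltrami hP.1).sub ((MvPolynomial.IsSymmetric.C _).mul hP.1)
  · by_cases h0 : coeffAt d P = 0
    · rw [coeffAt_shiftedLaplaceBeltrami hN, h0, mul_zero, zero_add] at hd
      obtain ⟨i, j, a, hij, ha, hne⟩ := exists_of_spreadSum_ne_zero hd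
      exact (hP.2 _ hne).of_spread hij ha
    · exact hP.2 d h0
  · rw [coeffAt_shiftedLaplaceBeltrami hN, sub_self, zero_mul, zero_add]
    by_contra h
    obtain ⟨i, j, a, hij, ha, hne⟩ := exists_of_spreadSum_ne_zero h
    exact ((hP.2 _ hne).maxSum_le hN).not_gt (maxSum_lt_maxSum_spread _ hij ha)

theorem exists_shiftedLaplaceBeltrami_eq (hN : lam.colLen 0 ≤ N)
    {Q : MvPolynomial (Fin N) QAlpha} (hQ : Q ∈ lowerSpace N lam) :
    ∃ P ∈ lowerSpace N lam, shiftedLaplaceBeltrami N lam P = Q := by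
  let T : lowerSpace N lam →ₗ[QAlpha] lowerSpace N lam :=
    (shiftedLaplaceBeltrami N lam).restrict fun P hP =>
      shiftedLaplaceBeltrami_mem_lowerSpace hN (mem_lowerSpace.mp hP).1
  have hT : Function.Injective T := by
    rw [injective_iff_map_eq_zero]
    exact fun P hP => Subtype.ext (eq_zero_of_triangular hN P.2 (congrArg Subtype.val hP))
  obtain ⟨P, hP⟩ := LinearMap.injective_iff_surjective.mp hT ⟨Q, hQ⟩
  exact ⟨P, P.2, congrArg Subtype.val hP⟩

end DominatedSpace

/-! ### Existence, uniqueness and stability of Jack polynomials -/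

section MonomialSymmetric

variable {σ R : Type*}

theorem prod_map_X [DecidableEq σ] [CommSemiring R] (s : Multiset σ) :
    (s.map (MvPolynomial.X (R := R))).prod = MvPolynomial.monomial (Multiset.toFinsupp s) 1 := by
  induction s using Multiset.induction_on with
  | empty => simp
  | cons a s ih =>
    rw [Multiset.map_cons, Multiset.prod_cons, ih, ← Multiset.singleton_add,
      Multiset.toFinsupp_add, Multiset.toFinsupp_singleton, MvPolynomial.X,
      MvPolynomial.monomial_mul, one_mul]

variable [Fintype σ]

/-- The multiset of nonzero entries of an exponent vector. -/
def nonzeroEntries (d : σ → ℕ) : Multiset ℕ := (Finset.univ.val.map d).filter (· ≠ 0)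

theorem nonzeroEntries_eq_map (d : σ → ℕ) :
    nonzeroEntries d = (Finset.univ.filter (d · ≠ 0)).val.map d := by
  rw [nonzeroEntries, Multiset.filter_map]
  rfl

theorem sum_nonzeroEntries (d : σ → ℕ) : (nonzeroEntries d).sum = ∑ i, d i := by
  rw [nonzeroEntries_eq_map]
  exact Finset.sum_filter_ne_zero Finset.univ

theorem nonzeroEntries_comp_perm (d : σ → ℕ) (e : Equiv.Perm σ) :
    nonzeroEntries (d ∘ e) = nonzeroEntries d := by
  rw [nonzeroEntries, nonzeroEntries, ← Multiset.map_map]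
  exact congrArg (fun s : Finset σ => (s.val.map d).filter (· ≠ 0)) (Finset.map_univ_equiv e)

variable [DecidableEq σ]

theorem parts_ofSym {n : ℕ} (s : Sym σ n) :
    (Nat.Partition.ofSym s).parts = nonzeroEntries (Multiset.toFinsupp s.1) := by
  rw [nonzeroEntries_eq_map]
  refine congrArg (fun t : Finset σ => t.val.map s.1.count) (a₁ := s.1.toFinset) ?_
  ext i
  simp

variable [CommSemiring R]

theorem coeffAt_msymm {n : ℕ} (mu : n.Partition) (d : σ → ℕ) :
    coeffAt d (MvPolynomial.msymm σ R mu) = if nonzeroEntries d = mu.parts then 1 else 0 := by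
  rw [MvPolynomial.msymm, map_sum]
  simp only [prod_map_X, coeffAt_monomial]
  split_ifs with h
  · have hd : Multiset.toFinsupp (Finsupp.equivFunOnFinite.symm d).toMultiset = d := by simp
    have hcard : (Finsupp.equivFunOnFinite.symm d).toMultiset.card = n := by
      rw [Finsupp.card_toMultiset, Finsupp.sum_fintype _ _ (fun _ => rfl), ← mu.parts_sum, ← h,
        sum_nonzeroEntries]
      rfl
    rw [Finset.sum_eq_single ⟨⟨_, hcard⟩, Nat.Partition.ext
      ((parts_ofSym _).trans (hd.symm ▸ h))⟩, if_pos hd]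
    · refine fun s _ hne => if_neg fun heq => hne (Subtype.ext (Subtype.ext ?_))
      exact Multiset.toFinsupp.injective (DFunLike.coe_injective (heq.trans hd.symm))
    · exact fun hn => absurd (Finset.mem_univ _) hn
  · refine Finset.sum_eq_zero fun s _ => if_neg fun heq => h ?_
    rw [← heq, ← parts_ofSym, s.2]

end MonomialSymmetric

section Shape

variable {N : ℕ} {lam : YoungDiagram}

theorem nonzeroEntries_rowVec (hN : lam.colLen 0 ≤ N) :
    nonzeroEntries (rowVec N lam) = (lam.rowLens : Multiset ℕ) := by
  have hrange : (Finset.univ.filter (rowVec N lam · ≠ 0)).map Fin.valEmbedding =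
      Finset.range (lam.colLen 0) := by
    ext k
    simp only [Finset.mem_map, Finset.mem_filter_univ, Finset.mem_range, rowVec, Ne,
      rowLen_eq_zero_iff, not_le]
    exact ⟨by rintro ⟨i, hi, rfl⟩; exact hi, fun hk => ⟨⟨k, hk.trans_le hN⟩, hk, rfl⟩⟩
  have h := congrArg (fun s : Finset ℕ => s.val.map lam.rowLen) hrange
  rw [Finset.map_val, Multiset.map_map] at h
  exact (nonzeroEntries_eq_map _).trans h

theorem rowLens_injective {nu : YoungDiagram}
    (h : (lam.rowLens : Multiset ℕ) = (nu.rowLens : Multiset ℕ)) : lam = nu :=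
  YoungDiagram.equivListRowLens.injective <| Subtype.ext <|
    (Multiset.coe_eq_coe.mp h).eq_of_sortedGE lam.rowLens_sorted nu.rowLens_sorted

theorem exists_rowVec_eq_of_antitone {d : Fin N → ℕ} (hd : Antitone d) :
    ∃ lam : YoungDiagram, lam.colLen 0 ≤ N ∧ d = rowVec N lam := by
  have hw : (List.ofFn d).SortedGE := List.sortedGE_ofFn_iff.mpr hd
  refine ⟨YoungDiagram.ofRowLens _ hw, ?_, funext fun i => ?_⟩
  · by_contra! h
    obtain ⟨hlt, -⟩ := YoungDiagram.mem_ofRowLens.mp (YoungDiagram.mem_iff_lt_colLen.mpr h)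
    simp at hlt
  · simpa [rowVec] using
      (YoungDiagram.rowLen_ofRowLens (hw := hw) (Fin.cast List.length_ofFn.symm i)).symm

theorem exists_shape (d : Fin N → ℕ) : ∃ lam : YoungDiagram, lam.colLen 0 ≤ N ∧
    ∃ e : Equiv.Perm (Fin N), d ∘ e = rowVec N lam := by
  obtain ⟨e, he⟩ := exists_perm_antitone d
  obtain ⟨lam, hN, hlam⟩ := exists_rowVec_eq_of_antitone he
  exact ⟨lam, hN, e, hlam⟩

/-- The partition obtained by sorting an exponent vector. -/
def shape (d : Fin N → ℕ) : YoungDiagram := (exists_shape d).choose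

theorem colLen_shape_le (d : Fin N → ℕ) : (shape d).colLen 0 ≤ N := (exists_shape d).choose_spec.1

theorem exists_perm_shape (d : Fin N → ℕ) :
    ∃ e : Equiv.Perm (Fin N), d ∘ e = rowVec N (shape d) := (exists_shape d).choose_spec.2

theorem rowLens_shape (d : Fin N → ℕ) : ((shape d).rowLens : Multiset ℕ) = nonzeroEntries d := by
  obtain ⟨e, he⟩ := exists_perm_shape d
  rw [← nonzeroEntries_comp_perm d e, he, nonzeroEntries_rowVec (colLen_shape_le d)]

theorem shape_rowVec (hN : lam.colLen 0 ≤ N) : shape (rowVec N lam) = lam :=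
  rowLens_injective (by rw [rowLens_shape, nonzeroEntries_rowVec hN])

theorem coeffAt_rowVec_shape {R : Type*} [CommSemiring R] {P : MvPolynomial (Fin N) R}
    (hP : P.IsSymmetric) (d : Fin N → ℕ) : coeffAt (rowVec N (shape d)) P = coeffAt d P := by
  obtain ⟨e, he⟩ := exists_perm_shape d
  rw [← he, isSymmetric_iff_coeffAt.mp hP]

theorem dominatedBy_rowVec_shape_iff {d : Fin N → ℕ} :
    DominatedBy lam (rowVec N (shape d)) ↔ DominatedBy lam d := by
  obtain ⟨e, he⟩ := exists_perm_shape d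
  rw [← he]
  refine ⟨fun h => ?_, fun h => h.comp_perm e⟩
  simpa [Function.comp_assoc] using h.comp_perm e⁻¹

open Classical in
theorem coeffAt_monomialSymm (d : Fin N → ℕ) (nu : YoungDiagram) :
    coeffAt d (monomialSymm N nu) = if shape d = nu then 1 else 0 := by
  have hparts : (Nat.Partition.ofMultiset (nu.rowLens : Multiset ℕ)).parts = nu.rowLens := by
    rw [Nat.Partition.ofMultiset_parts]
    exact Multiset.filter_eq_self.mpr fun a ha => (nu.pos_of_mem_rowLens a ha).ne'
  rw [monomialSymm, coeffAt_msymm, hparts, ← rowLens_shape]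
  exact if_congr ⟨rowLens_injective, fun h => by rw [h]⟩ rfl rfl

end Shape

section Jack

variable {N : ℕ} {lam nu : YoungDiagram} {P : MvPolynomial (Fin N) QAlpha}

theorem monomialSymm_mem_dominatedSpace (hcard : nu.card = lam.card)
    (h : ∀ j : ℕ, ∑ i ∈ Finset.range j, nu.rowLen i ≤ ∑ i ∈ Finset.range j, lam.rowLen i) :
    monomialSymm N nu ∈ dominatedSpace N lam := by
  refine mem_dominatedSpace.mpr ⟨MvPolynomial.msymm_isSymmetric _ _ _, fun d hd => ?_⟩
  classical
  rw [coeffAt_monomialSymm, ite_ne_right_iff] at hd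
  obtain ⟨rfl, -⟩ := hd
  exact dominatedBy_rowVec_shape_iff.mp (dominatedBy_rowVec (colLen_shape_le d) hcard h)

theorem C_mul_mem_dominatedSpace (c : QAlpha) (hP : P ∈ dominatedSpace N lam) :
    MvPolynomial.C c * P ∈ dominatedSpace N lam :=
  MvPolynomial.smul_eq_C_mul P c ▸ (dominatedSpace N lam).smul_mem c hP

theorem finite_support_coeffAt_rowVec (P : MvPolynomial (Fin N) QAlpha) :
    (Function.support fun nu : YoungDiagram =>
      if nu.colLen 0 ≤ N then coeffAt (rowVec N nu) P else 0).Finite := by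
  refine ((finite_support_coeffAt P).image shape).subset fun nu hnu => ?_
  obtain ⟨hN, hne⟩ := ite_ne_right_iff.mp hnu
  exact ⟨rowVec N nu, hne, shape_rowVec hN⟩

/-- The coefficients of a symmetric polynomial in the basis of monomial symmetric polynomials. -/
def monomialSymmCoeff (P : MvPolynomial (Fin N) QAlpha) : YoungDiagram →₀ QAlpha :=
  Finsupp.ofSupportFinite _ (finite_support_coeffAt_rowVec P)

theorem monomialSymmCoeff_apply (P : MvPolynomial (Fin N) QAlpha) (nu : YoungDiagram) :
    monomialSymmCoeff P nu = if nu.colLen 0 ≤ N then coeffAt (rowVec N nu) P else 0 := rfl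

theorem sum_monomialSymmCoeff (hP : P.IsSymmetric) :
    ((monomialSymmCoeff P).sum fun nu c => MvPolynomial.C c * monomialSymm N nu) = P := by
  classical
  refine ext_coeffAt fun d => ?_
  simp only [Finsupp.sum, map_sum, coeffAt_C_mul, coeffAt_monomialSymm, mul_ite, mul_one, mul_zero]
  rw [Finset.sum_ite_eq, Finsupp.if_mem_support, monomialSymmCoeff_apply,
    if_pos (colLen_shape_le d), coeffAt_rowVec_shape hP]

open Classical in
theorem dominanceLT_of_mem_support (hN : lam.colLen 0 ≤ N) (hP : P ∈ dominatedSpace N lam)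
    (hnu : nu ∈ ((monomialSymmCoeff P).erase lam).support) : DominanceLT nu lam := by
  rw [Finsupp.support_erase, Finset.mem_erase, Finsupp.mem_support_iff, monomialSymmCoeff_apply,
    ite_ne_right_iff] at hnu
  obtain ⟨hne, hnuN, hcoeff⟩ := hnu
  have hdom := (mem_dominatedSpace.mp hP).2 _ hcoeff
  exact ⟨(sum_rowVec hnuN).symm.trans hdom.1, hne, hdom.sum_range_rowLen_le hnuN hN⟩

theorem mem_dominatedSpace_iff_expansion (hN : lam.colLen 0 ≤ N) {c : QAlpha} :
    P ∈ dominatedSpace N lam ∧ coeffAt (rowVec N lam) P = c ↔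
      ∃ a : YoungDiagram →₀ QAlpha, (∀ nu ∈ a.support, DominanceLT nu lam) ∧
        P = MvPolynomial.C c * monomialSymm N lam +
          ∑ nu ∈ a.support, MvPolynomial.C (a nu) * monomialSymm N nu := by
  classical
  constructor
  · rintro ⟨hP, rfl⟩
    refine ⟨(monomialSymmCoeff P).erase lam, fun nu => dominanceLT_of_mem_support hN hP, ?_⟩
    have h := Finsupp.add_sum_erase' (monomialSymmCoeff P) lam
      (fun nu c => MvPolynomial.C c * monomialSymm N nu) fun nu => by rw [map_zero, zero_mul]
    rw [sum_monomialSymmCoeff (mem_dominatedSpace.mp hP).1, monomialSymmCoeff_apply,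
      if_pos hN] at h
    exact h.symm
  · rintro ⟨a, ha, rfl⟩
    refine ⟨add_mem
      (C_mul_mem_dominatedSpace _ (monomialSymm_mem_dominatedSpace rfl fun _ => le_rfl))
      (sum_mem fun nu hnu => C_mul_mem_dominatedSpace _
        (monomialSymm_mem_dominatedSpace (ha nu hnu).1 (ha nu hnu).2.2)), ?_⟩
    simp only [map_add, map_sum, coeffAt_C_mul, coeffAt_monomialSymm, shape_rowVec hN]
    rw [if_true, mul_one, Finset.sum_eq_zero, add_zero]
    exact fun nu hnu => by rw [if_neg (ha nu hnu).2.1.symm, mul_zero]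

theorem isJack_iff (hN : lam.colLen 0 ≤ N) : IsJack N lam P ↔ P ∈ dominatedSpace N lam ∧
    coeffAt (rowVec N lam) P = hook lam ∧ shiftedLaplaceBeltrami N lam P = 0 := by
  have eigen_iff (hs : P.IsSymmetric) :
      laplaceBeltrami N P = toRat N (MvPolynomial.C (eigenvalue N lam) * P) ↔
        shiftedLaplaceBeltrami N lam P = 0 := by
    rw [laplaceBeltrami_eq_toRat hs, shiftedLaplaceBeltrami_apply, sub_eq_zero]
    exact (IsFractionRing.injective (MvPolynomial (Fin N) QAlpha) (RatField N)).eq_iff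
  constructor
  · rintro ⟨hs, he, hexp⟩
    obtain ⟨hd, htop⟩ := (mem_dominatedSpace_iff_expansion hN).mpr hexp
    exact ⟨hd, htop, (eigen_iff hs).mp he⟩
  · rintro ⟨hd, htop, he⟩
    have hs := (mem_dominatedSpace.mp hd).1
    exact ⟨hs, (eigen_iff hs).mpr he, (mem_dominatedSpace_iff_expansion hN).mp ⟨hd, htop⟩⟩

theorem existsUnique_isJack (hN : lam.colLen 0 ≤ N) :
    ∃! P : MvPolynomial (Fin N) QAlpha, IsJack N lam P := by
  simp only [isJack_iff hN]
  set m : MvPolynomial (Fin N) QAlpha := MvPolynomial.C (hook lam) * monomialSymm N lam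
  have hm : m ∈ dominatedSpace N lam :=
    C_mul_mem_dominatedSpace _ (monomialSymm_mem_dominatedSpace rfl fun _ => le_rfl)
  have hmtop : coeffAt (rowVec N lam) m = hook lam := by
    rw [coeffAt_C_mul, coeffAt_monomialSymm, shape_rowVec hN, if_pos rfl, mul_one]
  obtain ⟨g, ⟨hg, hgtop : coeffAt (rowVec N lam) g = 0⟩, hgm⟩ :=
    exists_shiftedLaplaceBeltrami_eq hN (shiftedLaplaceBeltrami_mem_lowerSpace hN hm)
  have hshift : shiftedLaplaceBeltrami N lam (m - g) = 0 := by rw [map_sub, hgm, sub_self]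
  refine ⟨m - g, ⟨sub_mem hm hg, by rw [map_sub, hmtop, hgtop, sub_zero], hshift⟩, ?_⟩
  rintro Q ⟨hQ, hQtop, hQshift⟩
  refine sub_eq_zero.mp (eq_zero_of_triangular hN ⟨sub_mem hQ (sub_mem hm hg), ?_⟩ ?_)
  · change coeffAt (rowVec N lam) (Q - (m - g)) = 0
    rw [map_sub, map_sub, hQtop, hmtop, hgtop, sub_zero, sub_self]
  · rw [map_sub, hQshift, hshift, sub_zero]

theorem isJack_jack (hN : lam.colLen 0 ≤ N) : IsJack N lam (jack N lam) := by
  have h : lam.colLen 0 ≤ N ∧ ∃ P, IsJack N lam P := ⟨hN, (existsUnique_isJack hN).exists⟩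
  rw [jack, dif_pos h]
  exact h.2.choose_spec

theorem jack_eq_of_isJack (hN : lam.colLen 0 ≤ N) (h : IsJack N lam P) : jack N lam = P :=
  (existsUnique_isJack hN).unique (isJack_jack hN) h

theorem jack_eq_zero (hN : N < lam.colLen 0) : jack N lam = 0 :=
  dif_neg fun h => absurd h.1 hN.not_ge

end Jack

section Restriction

variable {N : ℕ} {lam : YoungDiagram} {P : MvPolynomial (Fin (N + 1)) QAlpha}

/-- Extension of an exponent vector by zero; the substitution `x_{N+1} = 0` reads off the
coefficients at such vectors. -/
def extendZero (d : Fin N → ℕ) : Fin (N + 1) → ℕ := Fin.snoc (α := fun _ => ℕ) d 0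

@[simp]
theorem extendZero_castSucc (d : Fin N → ℕ) (i : Fin N) : extendZero d i.castSucc = d i :=
  Fin.snoc_castSucc ..

@[simp]
theorem extendZero_last (d : Fin N → ℕ) : extendZero d (Fin.last N) = 0 := Fin.snoc_last ..

theorem eq_extendZero_iff {d : Fin N → ℕ} {e : Fin (N + 1) → ℕ} :
    e = extendZero d ↔ (fun i : Fin N => e i.castSucc) = d ∧ e (Fin.last N) = 0 := by
  simp [funext_iff, Fin.forall_fin_succ']

theorem restrictLast_monomial (m : Fin (N + 1) →₀ ℕ) (c : QAlpha) :
    restrictLast N (MvPolynomial.monomial m c) =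
      if m (Fin.last N) = 0 then
        MvPolynomial.monomial (Finsupp.equivFunOnFinite.symm fun i : Fin N => m i.castSucc) c
      else 0 := by
  rw [restrictLast, MvPolynomial.aeval_monomial, Finsupp.prod_fintype _ _ (fun _ => pow_zero _),
    Fin.prod_univ_castSucc, MvPolynomial.algebraMap_eq]
  simp only [Fin.snoc_castSucc, Fin.snoc_last]
  split_ifs with h
  · rw [h, pow_zero, mul_one, MvPolynomial.monomial_eq,
      Finsupp.prod_fintype _ _ (fun _ => pow_zero _)]
    rfl
  · rw [zero_pow h, mul_zero, mul_zero]

theorem coeffAt_restrictLast (d : Fin N → ℕ) (P : MvPolynomial (Fin (N + 1)) QAlpha) :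
    coeffAt d (restrictLast N P) = coeffAt (extendZero d) P := by
  induction P using MvPolynomial.induction_on' with
  | monomial m c =>
    simp only [restrictLast_monomial, apply_ite (coeffAt d), map_zero, coeffAt_monomial,
      eq_extendZero_iff, and_comm, ite_and]
    congr
  | add p q hp hq => rw [map_add, map_add, map_add, hp, hq]

theorem extendZero_spread (d : Fin N → ℕ) (i j : Fin N) (a : ℕ) :
    spread (extendZero d) i.castSucc j.castSucc a = extendZero (spread d i j a) := by
  simp only [spread, extendZero_castSucc]
  simp only [extendZero, Fin.snoc_update]

theorem sum_extendZero (d : Fin N → ℕ) : ∑ i, extendZero d i = ∑ i, d i := by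
  simp [Fin.sum_univ_castSucc]

theorem maxSum_extendZero (d : Fin N → ℕ) :
    maxSum (extendZero d) = maxSum d + 2 * ∑ i, d i := by
  simp only [maxSum, Fin.sum_univ_castSucc, extendZero_castSucc, extendZero_last, Nat.max_zero,
    Nat.zero_max, Finset.sum_add_distrib]
  ring

theorem diagEntry_extendZero (d : Fin N → ℕ) :
    diagEntry (extendZero d) = diagEntry d + (∑ i, d i : ℕ) := by
  have hchoose : ∑ i, (extendZero d i).choose 2 = ∑ i, (d i).choose 2 := by
    simp [Fin.sum_univ_castSucc]
  rw [diagEntry, diagEntry, maxSum_extendZero, sum_extendZero, hchoose]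
  push_cast
  ring

theorem spreadSum_extendZero (f : (Fin (N + 1) → ℕ) → QAlpha) (d : Fin N → ℕ) :
    spreadSum f (extendZero d) = spreadSum (fun d => f (extendZero d)) d := by
  simp [spreadSum, Finset.sum_filter, Fin.sum_univ_castSucc, extendZero_spread]

theorem rowVec_succ (hN : lam.colLen 0 ≤ N) : rowVec (N + 1) lam = extendZero (rowVec N lam) :=
  eq_extendZero_iff.mpr ⟨rfl, rowLen_eq_zero_iff.mpr hN⟩

theorem nonzeroEntries_extendZero (d : Fin N → ℕ) :
    nonzeroEntries (extendZero d) = nonzeroEntries d := by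
  rw [nonzeroEntries, Fin.univ_castSuccEmb, Finset.cons_val, Multiset.map_cons, extendZero_last,
    Multiset.filter_cons_of_neg _ (by simp), Finset.map_val, Multiset.map_map]
  exact congrArg (fun f : Fin N → ℕ => (Finset.univ.val.map f).filter (· ≠ 0))
    (funext (extendZero_castSucc d))

theorem shape_extendZero (d : Fin N → ℕ) : shape (extendZero d) = shape d :=
  rowLens_injective (by rw [rowLens_shape, rowLens_shape, nonzeroEntries_extendZero])

theorem shape_comp_perm (d : Fin N → ℕ) (e : Equiv.Perm (Fin N)) : shape (d ∘ e) = shape d :=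
  rowLens_injective (by rw [rowLens_shape, rowLens_shape, nonzeroEntries_comp_perm])

theorem isSymmetric_restrictLast (hP : P.IsSymmetric) : (restrictLast N P).IsSymmetric := by
  refine isSymmetric_iff_coeffAt.mpr fun e d => ?_
  rw [coeffAt_restrictLast, coeffAt_restrictLast, ← coeffAt_rowVec_shape hP,
    ← coeffAt_rowVec_shape hP (extendZero d), shape_extendZero, shape_extendZero, shape_comp_perm]

theorem DominatedBy.of_extendZero {d : Fin N → ℕ} (h : DominatedBy lam (extendZero d)) :
    DominatedBy lam d := by
  refine ⟨(sum_extendZero d).symm.trans h.1, fun S => ?_⟩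
  simpa using h.2 (S.map Fin.castSuccEmb)

theorem restrictLast_mem_dominatedSpace (hP : P ∈ dominatedSpace (N + 1) lam) :
    restrictLast N P ∈ dominatedSpace N lam := by
  rw [mem_dominatedSpace] at hP ⊢
  refine ⟨isSymmetric_restrictLast hP.1, fun d hd => ?_⟩
  rw [coeffAt_restrictLast] at hd
  exact (hP.2 _ hd).of_extendZero

theorem restrictLast_shiftedLaplaceBeltrami (hN : lam.colLen 0 ≤ N)
    (hP : P ∈ dominatedSpace (N + 1) lam) :
    restrictLast N (shiftedLaplaceBeltrami (N + 1) lam P) =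
      shiftedLaplaceBeltrami N lam (restrictLast N P) := by
  refine ext_coeffAt fun d => ?_
  rw [coeffAt_restrictLast, coeffAt_shiftedLaplaceBeltrami (hN.trans N.le_succ),
    coeffAt_shiftedLaplaceBeltrami hN, rowVec_succ hN, diagEntry_extendZero, diagEntry_extendZero,
    spreadSum_extendZero]
  simp only [coeffAt_restrictLast]
  by_cases h0 : coeffAt (extendZero d) P = 0
  · rw [h0, mul_zero, mul_zero]
  · rw [((mem_dominatedSpace.mp hP).2 _ h0).of_extendZero.1, sum_rowVec hN,
      add_sub_add_right_eq_sub]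

theorem isJack_restrictLast (hN : lam.colLen 0 ≤ N) (h : IsJack (N + 1) lam P) :
    IsJack N lam (restrictLast N P) := by
  obtain ⟨hd, htop, hshift⟩ := (isJack_iff (hN.trans N.le_succ)).mp h
  refine (isJack_iff hN).mpr ⟨restrictLast_mem_dominatedSpace hd, ?_, ?_⟩
  · rw [coeffAt_restrictLast, ← rowVec_succ hN, htop]
  · rw [← restrictLast_shiftedLaplaceBeltrami hN hd, hshift, map_zero]

theorem dominatedSpace_eq_bot (hN : N < lam.colLen 0) : dominatedSpace N lam = ⊥ := by
  refine (Submodule.eq_bot_iff _).mpr fun P hP => ext_coeffAt fun d => ?_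
  rw [map_zero]
  by_contra h
  obtain ⟨hsum, hle⟩ := (mem_dominatedSpace.mp hP).2 d h
  have hfirst : lam.card ≤ ∑ i ∈ Finset.range N, lam.rowLen i := by
    simpa [hsum] using hle Finset.univ
  have hrow : 0 < lam.rowLen N := Nat.pos_of_ne_zero (mt rowLen_eq_zero_iff.mp hN.not_ge)
  have hcard := sum_range_rowLen (lam := lam) le_rfl
  have hmono := Finset.sum_le_sum_of_subset (f := lam.rowLen) (Finset.range_mono hN)
  rw [Finset.sum_range_succ] at hmono
  lia

theorem restrictLast_jack (N : ℕ) (lam : YoungDiagram) :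
    restrictLast N (jack (N + 1) lam) = jack N lam := by
  rcases le_or_gt (lam.colLen 0) N with hN | hN
  · exact (jack_eq_of_isJack hN (isJack_restrictLast hN (isJack_jack (hN.trans N.le_succ)))).symm
  rw [jack_eq_zero hN]
  rcases le_or_gt (lam.colLen 0) (N + 1) with hN' | hN'
  · have hmem := restrictLast_mem_dominatedSpace ((isJack_iff hN').mp (isJack_jack hN')).1
    rwa [dominatedSpace_eq_bot hN] at hmem
  · rw [jack_eq_zero hN', map_zero]

end Restriction

/-! ### Cumulants of Jack polynomials -/

section Additivity

variable {σ : Type*} [Fintype σ] {N : ℕ} {lam mu nu : YoungDiagram}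

theorem colLen_le_of_rowLen_add (h : ∀ k, nu.rowLen k = lam.rowLen k + mu.rowLen k)
    (hl : lam.colLen 0 ≤ N) (hm : mu.colLen 0 ≤ N) : nu.colLen 0 ≤ N := by
  rw [← rowLen_eq_zero_iff] at *
  rw [h, hl, hm]

theorem card_of_rowLen_add (h : ∀ k, nu.rowLen k = lam.rowLen k + mu.rowLen k) :
    nu.card = lam.card + mu.card := by
  have hl := le_max_left (lam.colLen 0) (mu.colLen 0)
  have hm := le_max_right (lam.colLen 0) (mu.colLen 0)
  rw [← sum_range_rowLen hl, ← sum_range_rowLen hm,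
    ← sum_range_rowLen (colLen_le_of_rowLen_add h hl hm), ← Finset.sum_add_distrib]
  exact Finset.sum_congr rfl fun k _ => h k

theorem rowVec_of_rowLen_add (h : ∀ k, nu.rowLen k = lam.rowLen k + mu.rowLen k) :
    rowVec N nu = rowVec N lam + rowVec N mu := funext fun i => h i

theorem maxSum_add_of_antitone [LinearOrder σ] [LocallyFiniteOrderBot σ] {d e : σ → ℕ}
    (hd : Antitone d) (he : Antitone e) : maxSum (d + e) = maxSum d + maxSum e := by
  have hadd : maxSum (d + e) + ∑ i, (d + e) i = _ := maxSum_add_sum_of_antitone (hd.add he)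
  have hd := maxSum_add_sum_of_antitone hd
  have he := maxSum_add_sum_of_antitone he
  simp only [Pi.add_apply, Finset.sum_add_distrib] at hadd
  lia

theorem add_choose_two (a b : ℕ) : (a + b).choose 2 = a.choose 2 + b.choose 2 + a * b := by
  have h : ((a + b).choose 2 : ℚ) = a.choose 2 + b.choose 2 + a * b := by
    simp only [Nat.cast_choose_two]
    push_cast
    ring
  exact_mod_cast h

theorem diagEntry_add_of_antitone [LinearOrder σ] [LocallyFiniteOrderBot σ] {d e : σ → ℕ}
    (hd : Antitone d) (he : Antitone e) :
    diagEntry (d + e) = diagEntry d + diagEntry e + alpha * (dotProduct d e : ℕ) := by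
  have hchoose : ∑ i, ((d + e) i).choose 2 =
      ∑ i, (d i).choose 2 + ∑ i, (e i).choose 2 + dotProduct d e := by
    simp only [dotProduct, Pi.add_apply, add_choose_two, Finset.sum_add_distrib]
  rw [diagEntry, maxSum_add_of_antitone hd he, hchoose]
  simp only [diagEntry, Pi.add_apply, Finset.sum_add_distrib]
  push_cast
  ring

theorem eigenvalue_of_rowLen_add (h : ∀ k, nu.rowLen k = lam.rowLen k + mu.rowLen k)
    (hl : lam.colLen 0 ≤ N) (hm : mu.colLen 0 ≤ N) :
    eigenvalue N nu = eigenvalue N lam + eigenvalue N mu +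
      alpha * (dotProduct (rowVec N lam) (rowVec N mu) : ℕ) := by
  rw [eigenvalue_eq_diagEntry hl, eigenvalue_eq_diagEntry hm,
    eigenvalue_eq_diagEntry (colLen_le_of_rowLen_add h hl hm), rowVec_of_rowLen_add h,
    diagEntry_add_of_antitone (rowVec_antitone lam) (rowVec_antitone mu)]

theorem DominatedBy.add (h : ∀ k, nu.rowLen k = lam.rowLen k + mu.rowLen k) {d e : σ → ℕ}
    (hd : DominatedBy lam d) (he : DominatedBy mu e) : DominatedBy nu (d + e) := by
  refine ⟨?_, fun S => ?_⟩
  · rw [card_of_rowLen_add h, ← hd.1, ← he.1, ← Finset.sum_add_distrib]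
    rfl
  · simp only [Pi.add_apply, h, Finset.sum_add_distrib]
    exact add_le_add (hd.2 S) (he.2 S)

variable {P Q : MvPolynomial (Fin N) QAlpha}

theorem mul_mem_dominatedSpace (h : ∀ k, nu.rowLen k = lam.rowLen k + mu.rowLen k)
    (hP : P ∈ dominatedSpace N lam) (hQ : Q ∈ dominatedSpace N mu) :
    P * Q ∈ dominatedSpace N nu := by
  rw [mem_dominatedSpace] at *
  refine ⟨hP.1.mul hQ.1, fun d hd => ?_⟩
  obtain ⟨a, b, rfl, ha, hb⟩ := exists_coeffAt_ne_zero_of_mul hd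
  exact (hP.2 a ha).add h (hQ.2 b hb)

theorem coeffAt_rowVec_mul (h : ∀ k, nu.rowLen k = lam.rowLen k + mu.rowLen k)
    (hP : P ∈ dominatedSpace N lam) (hQ : Q ∈ dominatedSpace N mu) :
    coeffAt (rowVec N nu) (P * Q) = coeffAt (rowVec N lam) P * coeffAt (rowVec N mu) Q := by
  rw [mem_dominatedSpace] at hP hQ
  rw [rowVec_of_rowLen_add h]
  refine coeffAt_add_mul fun a b hab ha hb => eq_of_forall_sum_Iic_eq fun j => ?_
  have hle_a := (hP.2 a ha).sum_Iic_le j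
  have hle_b := (hQ.2 b hb).sum_Iic_le j
  have hsum := congrArg (fun d => ∑ i ∈ Finset.Iic j, d i) hab
  simp only [Pi.add_apply, Finset.sum_add_distrib] at hsum
  lia

end Additivity

section Leading

variable {ι : Type*} {N : ℕ} {lam : ι → YoungDiagram}

theorem rowLen_bot (k : ℕ) : (⊥ : YoungDiagram).rowLen k = 0 := by
  rw [YoungDiagram.rowLen_eq_card, Finset.card_eq_zero]
  rfl

theorem rowVec_bot : rowVec N ⊥ = 0 := funext fun i => rowLen_bot i

theorem coeffAt_zero_one : coeffAt (0 : Fin N → ℕ) (1 : MvPolynomial (Fin N) QAlpha) = 1 :=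
  (coeff_eq_coeffAt 0 1).symm.trans MvPolynomial.coeff_zero_one

theorem eq_C_of_mem_dominatedSpace_bot {P : MvPolynomial (Fin N) QAlpha}
    (hP : P ∈ dominatedSpace N ⊥) : P = MvPolynomial.C (coeffAt 0 P) := by
  refine ext_coeffAt fun d => ?_
  obtain rfl | hd := eq_or_ne d 0
  · rw [← mul_one (MvPolynomial.C _), coeffAt_C_mul, coeffAt_zero_one, mul_one]
  · rw [MvPolynomial.C_apply, coeffAt_monomial, Finsupp.coe_zero, if_neg hd.symm]
    by_contra hne
    have hsum : ∑ i, d i = 0 := ((mem_dominatedSpace.mp hP).2 d hne).1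
    exact hd (funext fun i => (Finset.sum_eq_zero_iff.mp hsum) i (Finset.mem_univ i))

theorem jack_bot : jack N ⊥ = 1 := by
  have hN : (⊥ : YoungDiagram).colLen 0 ≤ N := rowLen_eq_zero_iff.mp (rowLen_bot N)
  obtain ⟨hmem, htop, -⟩ := (isJack_iff hN).mp (isJack_jack hN)
  rw [eq_C_of_mem_dominatedSpace_bot hmem, ← rowVec_bot, htop, hook_bot, MvPolynomial.C_1]

variable [DecidableEq ι]

theorem rowLen_entrywiseSum_union {A B : Finset ι} (h : Disjoint A B) (k : ℕ) :
    (entrywiseSum lam (A ∪ B)).rowLen k =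
      (entrywiseSum lam A).rowLen k + (entrywiseSum lam B).rowLen k := by
  simp only [rowLen_entrywiseSum, Finset.sum_union h]

theorem cumulant_mem_dominatedSpace {u : Finset ι → MvPolynomial (Fin N) QAlpha} (hu : u ∅ = 1)
    (hdom : ∀ B, u B ∈ dominatedSpace N (entrywiseSum lam B)) {H : Finset ι} (hH : H.Nonempty) :
    cumulant u H ∈ dominatedSpace N (entrywiseSum lam H) ∧
      coeffAt (rowVec N (entrywiseSum lam H)) (cumulant u H) =
        cumulant (fun B => coeffAt (rowVec N (entrywiseSum lam B)) (u B)) H := by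
  have hu' : coeffAt (rowVec N (entrywiseSum lam ∅)) (u ∅) = 1 := by
    rw [hu, entrywiseSum_empty, rowVec_bot, coeffAt_zero_one]
  induction H using Finset.strongInduction with
  | H H ih =>
    obtain ⟨h, hh⟩ := hH
    have hsplit {A : Finset ι} (hA : A ∈ H.ssubsets.filter (h ∈ ·)) :
        A ⊂ H ∧ A.Nonempty ∧ ∀ k, (entrywiseSum lam H).rowLen k =
          (entrywiseSum lam A).rowLen k + (entrywiseSum lam (H \ A)).rowLen k := by
      obtain ⟨hAH, hhA⟩ := Finset.mem_filter.mp hA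
      rw [Finset.mem_ssubsets] at hAH
      refine ⟨hAH, ⟨h, hhA⟩, fun k => ?_⟩
      rw [← rowLen_entrywiseSum_union Finset.disjoint_sdiff,
        Finset.union_sdiff_of_subset hAH.subset]
    rw [cumulant_eq_sub hu hh, map_sub, map_sum,
      cumulant_eq_sub (u := fun B => coeffAt (rowVec N (entrywiseSum lam B)) (u B)) hu' hh]
    constructor
    · refine sub_mem (hdom H) (sum_mem fun A hA => ?_)
      obtain ⟨hAH, hne, hrow⟩ := hsplit hA
      exact mul_mem_dominatedSpace hrow (ih A hAH hne).1 (hdom _)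
    · refine congrArg _ (Finset.sum_congr rfl fun A hA => ?_)
      obtain ⟨hAH, hne, hrow⟩ := hsplit hA
      rw [coeffAt_rowVec_mul hrow (ih A hAH hne).1 (hdom _), (ih A hAH hne).2]

end Leading

section GammaForm

variable {A σ R : Type*} [CommRing R] [CommRing A] [Algebra A R] {M L : Submodule A R}
  {f g : MvPolynomial σ R}

theorem X_mul_pderiv_mem_coeffsIn [Finite σ] (hf : f ∈ MvPolynomial.coeffsIn σ M) (i : σ) :
    MvPolynomial.X i * MvPolynomial.pderiv i f ∈ MvPolynomial.coeffsIn σ M := fun d => by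
  rw [coeff_eq_coeffAt, coeffAt_X_mul_pderiv, ← nsmul_eq_mul, ← coeff_eq_coeffAt]
  exact nsmul_mem (hf d) _

variable [Fintype σ]

/-- The carré du champ `∑ x_i² ∂_i f ∂_i g` of the operator `(1/2) ∑ x_i² ∂_i²`, corrected by a
multiple of `f g` that absorbs the failure of the eigenvalues to be additive. -/
def gammaForm (c : ℕ) : MvPolynomial σ R →+ MvPolynomial σ R →+ MvPolynomial σ R :=
  let euler (i : σ) : MvPolynomial σ R →+ MvPolynomial σ R :=
    (AddMonoidHom.mulLeft (MvPolynomial.X i)).comp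
      (MvPolynomial.pderiv (R := R) i).toLinearMap.toAddMonoidHom
  let mul : MvPolynomial σ R →+ MvPolynomial σ R →+ MvPolynomial σ R := AddMonoidHom.mul
  ∑ i, (mul.compl₂ (euler i)).comp (euler i) - c • mul

theorem gammaForm_apply (c : ℕ) (f g : MvPolynomial σ R) : gammaForm c f g =
    ∑ i, (MvPolynomial.X i * MvPolynomial.pderiv i f) *
      (MvPolynomial.X i * MvPolynomial.pderiv i g) - c * (f * g) := by
  simp [gammaForm]

theorem gammaForm_mul (a b : ℕ) (f g k : MvPolynomial σ R) :
    gammaForm (a + b) f (g * k) = gammaForm a f g * k + g * gammaForm b f k := by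
  have hsum : ∑ i, (MvPolynomial.X i * MvPolynomial.pderiv i f) *
        (MvPolynomial.X i * MvPolynomial.pderiv i (g * k)) =
      (∑ i, (MvPolynomial.X i * MvPolynomial.pderiv i f) *
        (MvPolynomial.X i * MvPolynomial.pderiv i g)) * k +
      g * ∑ i, (MvPolynomial.X i * MvPolynomial.pderiv i f) *
        (MvPolynomial.X i * MvPolynomial.pderiv i k) := by
    rw [Finset.sum_mul, Finset.mul_sum, ← Finset.sum_add_distrib]
    refine Finset.sum_congr rfl fun i _ => ?_
    rw [MvPolynomial.pderiv_mul]
    ring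
  rw [gammaForm_apply, hsum, gammaForm_apply, gammaForm_apply]
  push_cast
  ring

theorem gammaForm_mem_coeffsIn (c : ℕ) (hf : f ∈ MvPolynomial.coeffsIn σ M)
    (hg : g ∈ MvPolynomial.coeffsIn σ L) :
    gammaForm c f g ∈ MvPolynomial.coeffsIn σ (M * L) := by
  rw [gammaForm_apply, MvPolynomial.coeffsIn_mul, ← nsmul_eq_mul]
  exact sub_mem (sum_mem fun i _ => Submodule.mul_mem_mul (X_mul_pderiv_mem_coeffsIn hf i)
    (X_mul_pderiv_mem_coeffsIn hg i)) (nsmul_mem (Submodule.mul_mem_mul hf hg) c)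

end GammaForm

section ProductRule

variable {N : ℕ}

theorem D1_mul (f g : MvPolynomial (Fin N) QAlpha) :
    D1 N (f * g) = D1 N f * toRat N g + toRat N f * D1 N g := by
  simp only [D1, Finset.sum_mul, Finset.mul_sum, ← Finset.sum_add_distrib]
  refine Finset.sum_congr rfl fun i _ => Finset.sum_congr rfl fun j _ => ?_
  rw [MvPolynomial.pderiv_mul, map_add, map_mul, map_mul]
  ring

theorem D2_mul (f g : MvPolynomial (Fin N) QAlpha) :
    D2 N (f * g) = D2 N f * g + f * D2 N g + gammaForm 0 f g := by
  have two_mul_D2 (P : MvPolynomial (Fin N) QAlpha) :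
      2 * D2 N P = ∑ i, MvPolynomial.X i ^ 2 * MvPolynomial.pderiv i (MvPolynomial.pderiv i P) := by
    rw [D2, ← mul_assoc, ← map_ofNat MvPolynomial.C 2, ← MvPolynomial.C_mul]
    norm_num
  have h : 2 * D2 N (f * g) = 2 * D2 N f * g + f * (2 * D2 N g) + 2 * gammaForm 0 f g := by
    simp only [two_mul_D2, gammaForm_apply, Nat.cast_zero, zero_mul, sub_zero, Finset.sum_mul,
      Finset.mul_sum, ← Finset.sum_add_distrib, MvPolynomial.pderiv_mul, map_add]
    exact Finset.sum_congr rfl fun i _ => by ring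
  exact mul_left_cancel₀ two_ne_zero (by rw [h]; ring)

/-- The operator `D_α - c`, as an additive map into rational functions, where no symmetry of the
argument is required. -/
def laplaceBeltramiSub (N : ℕ) (c : QAlpha) : MvPolynomial (Fin N) QAlpha →+ RatField N :=
  AddMonoidHom.mk' (fun f => laplaceBeltrami N f - toRat N (MvPolynomial.C c * f)) fun f g => by
    simp only [laplaceBeltrami, D1, D2, map_add, mul_add, Finset.sum_add_distrib]
    ring

theorem laplaceBeltramiSub_apply (c : QAlpha) (f : MvPolynomial (Fin N) QAlpha) :
    laplaceBeltramiSub N c f = laplaceBeltrami N f - toRat N (MvPolynomial.C c * f) := rfl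

theorem laplaceBeltramiSub_mul (a b : QAlpha) (c : ℕ) (f g : MvPolynomial (Fin N) QAlpha) :
    laplaceBeltramiSub N (a + b + alpha * c) (f * g) =
      laplaceBeltramiSub N a f * toRat N g + toRat N f * laplaceBeltramiSub N b g +
        toRat N (MvPolynomial.C alpha * gammaForm c f g) := by
  simp only [laplaceBeltramiSub_apply, laplaceBeltrami, D1_mul, D2_mul, gammaForm_apply,
    map_add, map_sub, map_mul, map_natCast, Nat.cast_zero, zero_mul, sub_zero]
  ring

theorem laplaceBeltramiSub_eq_toRat {lam : YoungDiagram} {P : MvPolynomial (Fin N) QAlpha}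
    (hP : P.IsSymmetric) :
    laplaceBeltramiSub N (eigenvalue N lam) P = toRat N (shiftedLaplaceBeltrami N lam P) := by
  rw [laplaceBeltramiSub_apply, laplaceBeltrami_eq_toRat hP, shiftedLaplaceBeltrami_apply, map_sub]

end ProductRule

section JackCumulants

variable {ι : Type*} {N : ℕ} {lam : ι → YoungDiagram}

/-- The set function `B ↦ J_{lam^B}`, whose cumulants are those of Jack polynomials. -/
def jackFamily (N : ℕ) (lam : ι → YoungDiagram) (B : Finset ι) : MvPolynomial (Fin N) QAlpha :=
  jack N (entrywiseSum lam B)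

theorem jackFamily_empty : jackFamily N lam ∅ = 1 := by
  rw [jackFamily, entrywiseSum_empty, jack_bot]

theorem isJack_jackFamily (hN : ∀ i, (lam i).colLen 0 ≤ N) (B : Finset ι) :
    IsJack N (entrywiseSum lam B) (jackFamily N lam B) :=
  isJack_jack (colLen_entrywiseSum_le fun i _ => hN i)

theorem jackFamily_eq_zero {i : ι} (hi : N < (lam i).colLen 0) {B : Finset ι} (hiB : i ∈ B) :
    jackFamily N lam B = 0 := by
  refine jack_eq_zero ?_
  rw [← not_le, ← rowLen_eq_zero_iff, rowLen_entrywiseSum] at *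
  exact fun h => hi (Finset.sum_eq_zero_iff.mp h i hiB)

variable [DecidableEq ι]

theorem cumulant_jackFamily_mem_dominatedSpace (hN : ∀ i, (lam i).colLen 0 ≤ N) {H : Finset ι}
    (hH : H.Nonempty) :
    cumulant (jackFamily N lam) H ∈ dominatedSpace N (entrywiseSum lam H) ∧
      coeffAt (rowVec N (entrywiseSum lam H)) (cumulant (jackFamily N lam) H) =
        cumulant (fun B => hook (entrywiseSum lam B)) H := by
  have hJ (B : Finset ι) := (isJack_iff (colLen_entrywiseSum_le fun i _ => hN i)).mp
    (isJack_jackFamily hN B)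
  have h := cumulant_mem_dominatedSpace jackFamily_empty (fun B => (hJ B).1) hH
  simpa only [(hJ _).2.1] using h

theorem shiftedLaplaceBeltrami_cumulant_jackFamily (hN : ∀ i, (lam i).colLen 0 ≤ N)
    {H : Finset ι} {h : ι} (hh : h ∈ H) :
    shiftedLaplaceBeltrami N (entrywiseSum lam H) (cumulant (jackFamily N lam) H) =
      -(MvPolynomial.C alpha * ∑ A ∈ H.powerset,
        gammaForm (dotProduct (rowVec N (entrywiseSum lam A)) (rowVec N (entrywiseSum lam (H \ A))))
          (pointed h (cumulant (jackFamily N lam)) A)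
          (reducedCumulant (jackFamily N lam) (H \ A))) := by
  have hcol (B : Finset ι) : (entrywiseSum lam B).colLen 0 ≤ N :=
    colLen_entrywiseSum_le fun i _ => hN i
  have hevol := secondOrder_cumulant (φ := toRat N) (c := MvPolynomial.C alpha)
    (T := fun A => laplaceBeltramiSub N (eigenvalue N (entrywiseSum lam A)))
    (Γ := fun A B =>
      gammaForm (dotProduct (rowVec N (entrywiseSum lam A)) (rowVec N (entrywiseSum lam B))))
    (fun A B hAB f g => by
      rw [eigenvalue_of_rowLen_add (rowLen_entrywiseSum_union hAB) (hcol A) (hcol B),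
        laplaceBeltramiSub_mul])
    (fun A B C hBC f g k => by
      rw [rowVec_of_rowLen_add (rowLen_entrywiseSum_union hBC), dotProduct_add, gammaForm_mul])
    jackFamily_empty (fun B => sub_eq_zero.mpr (isJack_jackFamily hN B).eigen) hh
  have hsymm := (mem_dominatedSpace.mp (cumulant_jackFamily_mem_dominatedSpace hN ⟨h, hh⟩).1).1
  rw [laplaceBeltramiSub_eq_toRat hsymm, ← map_neg] at hevol
  exact IsFractionRing.injective (MvPolynomial (Fin N) QAlpha) (RatField N) hevol

theorem C_alpha_mul_gammaForm_mem {H A : Finset ι} (hA : A ⊆ H) (hne : A.Nonempty)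
    (hne' : (H \ A).Nonempty) (c : ℕ) {f g : MvPolynomial (Fin N) QAlpha}
    (hf : f ∈ MvPolynomial.coeffsIn (Fin N) (alphaIdeal ^ (A.card - 1)))
    (hg : g ∈ MvPolynomial.coeffsIn (Fin N) (alphaIdeal ^ ((H \ A).card - 1))) :
    MvPolynomial.C alpha * gammaForm c f g ∈
      MvPolynomial.coeffsIn (Fin N) (alphaIdeal ^ (H.card - 1)) := fun d => by
  have hcard := Finset.card_sdiff_add_card_eq_card hA
  have hpos := hne.card_pos
  have hpos' := hne'.card_pos
  have hexp : H.card - 1 = 1 + ((A.card - 1) + ((H \ A).card - 1)) := by omega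
  rw [MvPolynomial.coeff_C_mul, hexp, pow_add, pow_one, pow_add]
  exact Submodule.mul_mem_mul alpha_mem_alphaIdeal (gammaForm_mem_coeffsIn c hf hg d)

theorem cumulant_jackFamily_mem_coeffsIn (hN : ∀ i, (lam i).colLen 0 ≤ N) {H : Finset ι}
    (hH : H.Nonempty) : cumulant (jackFamily N lam) H ∈
      MvPolynomial.coeffsIn (Fin N) (alphaIdeal ^ (H.card - 1)) := by
  induction H using Finset.strongInduction with
  | H H ih =>
    obtain ⟨h, hh⟩ := hH
    obtain ⟨hmem, htop⟩ := cumulant_jackFamily_mem_dominatedSpace hN ⟨h, hh⟩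
    have hshift : shiftedLaplaceBeltrami N (entrywiseSum lam H) (cumulant (jackFamily N lam) H) ∈
        MvPolynomial.coeffsIn (Fin N) (alphaIdeal ^ (H.card - 1)) := by
      rw [shiftedLaplaceBeltrami_cumulant_jackFamily hN hh, Finset.mul_sum]
      refine neg_mem (sum_mem fun A hA => ?_)
      rw [Finset.mem_powerset] at hA
      unfold pointed reducedCumulant
      split_ifs with hhA hempty
      · simp only [map_zero, mul_zero, zero_mem]
      · have hne' : (H \ A).Nonempty := Finset.nonempty_iff_ne_empty.mpr hempty
        have hAH : A ⊂ H := hA.ssubset_of_ne fun e => hempty (by simp [e])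
        exact C_alpha_mul_gammaForm_mem hA ⟨h, hhA⟩ hne' _ (ih A hAH ⟨h, hhA⟩)
          (ih (H \ A) (Finset.sdiff_ssubset hA ⟨h, hhA⟩) hne')
      all_goals simp only [map_zero, AddMonoidHom.zero_apply, mul_zero, zero_mem]
    intro d
    rw [coeff_eq_coeffAt]
    refine coeffAt_mem_of_triangular _ (colLen_entrywiseSum_le fun i _ => hN i) hmem ?_
      (fun d => ?_) d
    · rw [htop]
      exact cumulant_hook_mem hN ⟨h, hh⟩
    · rw [coeffAt_apply]
      exact hshift _

theorem cumulant_eq_zero_of_mem {R : Type*} [CommRing R] {u : Finset ι → R} {H : Finset ι} {i : ι}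
    (hi : i ∈ H) (hu : ∀ B, i ∈ B → u B = 0) : cumulant u H = 0 := by
  refine Finset.sum_eq_zero fun p _ => ?_
  obtain ⟨B, hB, hiB⟩ := p.exists_mem hi
  rw [Finset.prod_eq_zero hB (hu B hiB), mul_zero]

theorem isOAlpha_coeff_jackCumulant {r : ℕ} (hr : 1 ≤ r) (lam : Fin r → YoungDiagram) (N : ℕ)
    (d : Fin N →₀ ℕ) :
    IsOAlpha ((r : ℤ) - 1) (MvPolynomial.coeff d (jackCumulant N lam)) := by
  suffices h : cumulant (jackFamily N lam) Finset.univ ∈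
      MvPolynomial.coeffsIn (Fin N) (alphaIdeal ^ (r - 1)) by
    rw [← Nat.cast_one, ← Nat.cast_sub hr]
    exact isOAlpha_iff_mem_alphaIdeal_pow.mpr (h d)
  by_cases hN : ∀ i, (lam i).colLen 0 ≤ N
  · simpa using cumulant_jackFamily_mem_coeffsIn hN (H := Finset.univ) ⟨⟨0, hr⟩, Finset.mem_univ _⟩
  · push Not at hN
    obtain ⟨i, hi⟩ := hN
    rw [cumulant_eq_zero_of_mem (Finset.mem_univ i) fun B hiB => jackFamily_eq_zero hi hiB]
    exact zero_mem _

end JackCumulants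

end JackCumulant

end

/-- The first two items say that the Jack polynomials exist, are unique, and are compatible when the
number of variables varies (so that they define symmetric functions); the third is the estimate of
their cumulants, coefficient by coefficient and in any number of variables. -/
theorem mainTheorem2 :
    (∀ (N : ℕ) (lam : YoungDiagram), lam.colLen 0 ≤ N →
      ∃! P : MvPolynomial (Fin N) JackCumulant.QAlpha, JackCumulant.IsJack N lam P) ∧
    (∀ (N : ℕ) (lam : YoungDiagram),
      JackCumulant.restrictLast N (JackCumulant.jack (N + 1) lam) = JackCumulant.jack N lam) ∧
    (∀ (r : ℕ), 1 ≤ r → ∀ (lam : Fin r → YoungDiagram) (N : ℕ) (d : Fin N →₀ ℕ),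
      JackCumulant.IsOAlpha ((r : ℤ) - 1)
        (MvPolynomial.coeff d (JackCumulant.jackCumulant N lam))) :=
  ⟨fun _ _ hN => JackCumulant.existsUnique_isJack hN, JackCumulant.restrictLast_jack,
    fun _ hr lam N d => JackCumulant.isOAlpha_coeff_jackCumulant hr lam N d⟩
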